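/- Let $\mathbb T=(\mathbb R\cup\{-\infty\},\max,+)$ be the tropical semiring, let $k$ be a field with a non-archimedean valuation $\nu:k\to\mathbb T$ (multiplicative, $\nu(0)=-\infty$, $\nu(1)=0$, $\nu(-a)=\nu(a)$, $\nu(a+b)\le\max(\nu(a),\nu(b))$; the trivial valuation is allowed), and let $X$ be an integral scheme over $k$ with an open affine covering $\mathcal U$. *Universal tropicalization.* For a commutative monoid with zero $B$ and a semiring $S$, let $B\otimes_{\mathbb F_1}S$ be the $S$-algebra that is free as an $S$-module on monomials $x_b$, $0\neq b\in B$, with $x_ax_b=x_{ab}$ and $x_0=0$. Let $M(X)$ be the $\mathbb F_1$-scheme obtained by replacing the coordinate rings $A=\Gamma(V,\mathcal O_X)$ of the members of $\mathcal U$ and of their principal open subsets $V$ by their multiplicative monoids and gluing along common principal open subsets. The universal embedding $X\hookrightarrow\widehat X=M(X)\times_{\mathbb F_1}k$ is given on the patch of $V$ by the evaluation map $ev: A\otimes_{\mathbb F_1}k\to A$, $\sum\lambda_ax_a\mapsto\sum\lambda_aa$. The universal tropicalization $\mathrm{Trop}_{univ}(X)$ is the closed subscheme of the $\mathbb T$-scheme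 $M(X)\times_{\mathbb F_1}\mathbb T$ cut out on the patch of $V$ by the congruence generated by the bend relations $f\sim f_{\hat b}$ ($f_{\hat b}$ is $f$ with the term of $b$ deleted) for all monomials $b$ and all $f$ in the $\mathbb T$-linear span of the coefficientwise valuations of the elements of $\ker(ev)$. The set-theoretic tropicalization of $X$ in $\widehat X$ is the set of $\mathbb T$-points $q$ of $M(X)\times_{\mathbb F_1}\mathbb T$ such that, for each $\sum\lambda_ax_a\in\ker(ev)$ on a patch containing $q$, the maximum of the $q(\nu(\lambda_a)x_a)$ is $-\infty$ or is attained at least twice. *Analytification.* $X^{\mathrm{an}}$ is the set of pairs $z=(x,|\cdot|)$ of a point $x\in X$ and a non-archimedean absolute value on the residue field $\kappa(x)$ extending the absolute value $\exp\circ\nu$ of $k$, with the coarsest topology for which $z\mapsto x$ is continuous and $z\mapsto|f(x)|$ is continuous on the preimage of $U$ for every open $U\subseteq X$ and every $f\in\Gamma(U,\mathcal O_X)$. **Theorem A.** The inclusion of $\mathrm{Trop}_{univ}(X)(\mathbb T)$ into $(M(X)\times_{\mathbb F_1}\mathbb T)(\mathbb T)$ is injective, and its image is the set-theoretic tropicalization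 of $X$ in $\widehat X$. The sets $Z(\mathbb T)$, for $Z$ a closed subscheme (quasi-coherent congruence sheaf) of $\mathrm{Trop}_{univ}(X)$, are exactly the closed sets of a topology on $\mathrm{Trop}_{univ}(X)(\mathbb T)$, the strong Zariski topology. With this topology there is a unique homeomorphism $\mathrm{Trop}_{univ}(X)(\mathbb T)\to X^{\mathrm{an}}$ that sends a $\mathbb T$-point $\varphi$ of the patch of $V$ to a point $(x,|\cdot|)$ with $x\in V$ and $|f(x)|=\exp\varphi(x_f)$ for all $f\in\Gamma(V,\mathcal O_X)$. In particular, the set-theoretic tropicalization of $X$ in $\widehat X$ is canonically in bijection with $X^{\mathrm{an}}$. -/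

import Mathlib

open CategoryTheory AlgebraicGeometry

universe u v w


/-- The tropical semiring `(ℝ ∪ {-∞}, max, +)`. -/
def TropicalReal : Type := WithBot ℝ

namespace TropicalReal

noncomputable instance : LinearOrder TropicalReal := inferInstanceAs (LinearOrder (WithBot ℝ))

/-- The exponential `ℝ ∪ {-∞} → ℝ`, with `exp (-∞) = 0`. -/
noncomputable def exp (t : TropicalReal) : ℝ := WithBot.recBotCoe (C := fun _ => ℝ) 0 Real.exp t

noncomputable instance : Add TropicalReal := ⟨fun a b => max a b⟩
noncomputable instance : Zero TropicalReal := ⟨(⊥ : WithBot ℝ)⟩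
noncomputable instance : Mul TropicalReal :=
  ⟨fun a b => (show WithBot ℝ from a) + (show WithBot ℝ from b)⟩
noncomputable instance : One TropicalReal := ⟨(0 : WithBot ℝ)⟩

noncomputable instance : CommSemiring TropicalReal where
  nsmul := nsmulRec
  add_assoc a b c := max_assoc (α := WithBot ℝ) a b c
  zero_add a := max_eq_right (bot_le : (⊥ : WithBot ℝ) ≤ a)
  add_zero a := max_eq_left (bot_le : (⊥ : WithBot ℝ) ≤ a)
  add_comm a b := max_comm (α := WithBot ℝ) a b
  mul_assoc a b c := add_assoc (G := WithBot ℝ) a b c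
  one_mul a := zero_add (M := WithBot ℝ) a
  mul_one a := add_zero (M := WithBot ℝ) a
  mul_comm a b := add_comm (G := WithBot ℝ) a b
  zero_mul a := WithBot.bot_add (α := ℝ) a
  mul_zero a := WithBot.add_bot (α := ℝ) a
  left_distrib a b c := add_max (α := WithBot ℝ) a b c
  right_distrib a b c := max_add (α := WithBot ℝ) a b c

theorem add_def (a b : TropicalReal) : a + b = max a b := rfl

instance : IsLocalRing TropicalReal where
  exists_pair_ne := ⟨(⊥ : WithBot ℝ), (0 : WithBot ℝ), WithBot.bot_ne_coe⟩
  isUnit_or_isUnit_of_add_one {a b} h := by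
    rw [add_def] at h
    rcases max_choice a b with h' | h'
    · exact Or.inl (by rw [← h', h]; exact isUnit_one)
    · exact Or.inr (by rw [← h', h]; exact isUnit_one)

end TropicalReal

/-- A valuation on a ring `R` with values in an (idempotent) semiring `S`. -/
structure SemiringValuation (R : Type u) (S : Type v) [CommRing R] [CommSemiring S] where
  toFun : R → S
  map_zero : toFun 0 = 0
  map_one : toFun 1 = 1
  map_mul : ∀ a b, toFun (a * b) = toFun a * toFun b
  map_neg : ∀ a, toFun (-a) = toFun a
  subadditive : ∀ a b, toFun (a + b) + toFun a + toFun b = toFun a + toFun b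

/-- The scalar extension `B ⊗_{𝔽₁} S` of a monoid with zero `B`: the free `S`-module on the nonzero
elements of `B`, encoded as the finitely supported functions on `B` that vanish at `0`. -/
@[ext] structure ScalarExt (S : Type u) [CommSemiring S] (B : Type v) [CommMonoidWithZero B] where
  coeff : B →₀ S
  coeff_zero : coeff 0 = 0

namespace ScalarExt

section basic

variable {S : Type u} [CommSemiring S] {B : Type v} [CommMonoidWithZero B]

/-- The quotient map from the monoid algebra, which sets the monomial of `0 : B` to zero. -/
noncomputable def proj (f : MonoidAlgebra S B) : ScalarExt S B :=
  ⟨f.coeff.erase 0, Finsupp.erase_same⟩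

/-- The representative in the monoid algebra without a term at `0 : B`. -/
def toMA (f : ScalarExt S B) : MonoidAlgebra S B := .ofCoeff f.coeff

theorem toMA_coeff (f : ScalarExt S B) : f.toMA.coeff = f.coeff := rfl

theorem proj_toMA (f : ScalarExt S B) : proj f.toMA = f := by
  ext b
  by_cases hb : b = 0
  · subst hb; simp [proj, f.coeff_zero]
  · simp [proj, toMA, Finsupp.erase_ne hb]

theorem proj_surjective : Function.Surjective (proj : MonoidAlgebra S B → ScalarExt S B) :=
  fun f => ⟨f.toMA, f.proj_toMA⟩

theorem toMA_proj_add (f : MonoidAlgebra S B) :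
    (proj f).toMA + MonoidAlgebra.single 0 (f.coeff 0) = f := by
  ext b
  by_cases hb : b = 0
  · subst hb; simp [proj, toMA]
  · simp [proj, toMA]

noncomputable instance : Zero (ScalarExt S B) := ⟨proj 0⟩
noncomputable instance : One (ScalarExt S B) := ⟨proj 1⟩
noncomputable instance : Add (ScalarExt S B) :=
  ⟨fun f g => ⟨f.coeff + g.coeff, by simp [f.coeff_zero, g.coeff_zero]⟩⟩
noncomputable instance : Mul (ScalarExt S B) := ⟨fun f g => proj (f.toMA * g.toMA)⟩
noncomputable instance : SMul S (ScalarExt S B) :=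
  ⟨fun s f => ⟨s • f.coeff, by simp [f.coeff_zero]⟩⟩
noncomputable instance : SMul ℕ (ScalarExt S B) := ⟨fun n f => proj (n • f.toMA)⟩
noncomputable instance : Pow (ScalarExt S B) ℕ := ⟨fun f n => proj (f.toMA ^ n)⟩
noncomputable instance : NatCast (ScalarExt S B) := ⟨fun n => proj n⟩

theorem zero_coeff : (0 : ScalarExt S B).coeff = 0 := Finsupp.erase_zero 0

theorem coeff_add (f g : ScalarExt S B) : (f + g).coeff = f.coeff + g.coeff := rfl

theorem coeff_smul (s : S) (f : ScalarExt S B) : (s • f).coeff = s • f.coeff := rfl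

theorem proj_add (f g : MonoidAlgebra S B) : proj (f + g) = proj f + proj g := by
  ext b
  simp [proj, coeff_add, Finsupp.erase_add]

theorem proj_single_zero_mul (s : S) (f : MonoidAlgebra S B) :
    proj (MonoidAlgebra.single 0 s * f) = proj 0 := by
  induction f using MonoidAlgebra.induction_linear with
  | zero => simp
  | add f g hf hg => rw [mul_add, proj_add, hf, hg, ← proj_add, add_zero]
  | single b t =>
    rw [MonoidAlgebra.single_mul_single, zero_mul]
    simp only [proj, MonoidAlgebra.coeff_single, Finsupp.erase_single, MonoidAlgebra.coeff_zero,
      Finsupp.erase_zero]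

theorem proj_add_single_zero_mul (f g : MonoidAlgebra S B) (s : S) :
    proj ((f + MonoidAlgebra.single 0 s) * g) = proj (f * g) := by
  rw [add_mul, proj_add, proj_single_zero_mul, ← proj_add, add_zero]

theorem proj_mul (f g : MonoidAlgebra S B) : proj (f * g) = proj f * proj g := by
  conv_lhs => rw [← toMA_proj_add f, proj_add_single_zero_mul, mul_comm,
    ← toMA_proj_add g, proj_add_single_zero_mul, mul_comm]
  rfl

theorem proj_pow (f : MonoidAlgebra S B) (n : ℕ) : proj (f ^ n) = proj f ^ n := by
  change _ = proj ((proj f).toMA ^ n)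
  induction n with
  | zero => simp
  | succ n ih => rw [pow_succ, pow_succ, proj_mul, proj_mul, ih, proj_toMA]

theorem proj_nsmul (n : ℕ) (f : MonoidAlgebra S B) : proj (n • f) = n • proj f := by
  change _ = proj (n • (proj f).toMA)
  induction n with
  | zero => simp
  | succ n ih => rw [succ_nsmul, succ_nsmul, proj_add, proj_add, ih, proj_toMA]

noncomputable instance : CommSemiring (ScalarExt S B) :=
  Function.Surjective.commSemiring proj proj_surjective rfl rfl proj_add proj_mul
    (fun _ _ => proj_nsmul _ _) proj_pow (fun _ => rfl)

/-- `proj` as a ring homomorphism. -/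
noncomputable def projHom : MonoidAlgebra S B →+* ScalarExt S B where
  toFun := proj
  map_one' := rfl
  map_mul' := proj_mul
  map_zero' := rfl
  map_add' := proj_add

theorem proj_smul (s : S) (f : MonoidAlgebra S B) : proj (s • f) = s • proj f := by
  ext b
  by_cases hb : b = 0
  · subst hb; simp [proj, coeff_smul]
  · simp [proj, coeff_smul, Finsupp.erase_ne hb]

noncomputable instance : Algebra S (ScalarExt S B) where
  algebraMap := projHom.comp (algebraMap S (MonoidAlgebra S B))
  commutes' _ _ := mul_comm _ _
  smul_def' s f := by
    obtain ⟨f, rfl⟩ := proj_surjective f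
    rw [← proj_smul, Algebra.smul_def, proj_mul]; rfl

/-- The monomials `x_b`, satisfying `x_a x_b = x_{ab}`, `x_1 = 1` and `x_0 = 0`. -/
noncomputable def x : B →*₀ ScalarExt S B where
  toFun b := proj (MonoidAlgebra.single b 1)
  map_zero' := by
    change _ = proj 0
    ext c; simp [proj]
  map_one' := rfl
  map_mul' a b := by rw [← proj_mul, MonoidAlgebra.single_mul_single, one_mul]

/-- The universal property: a homomorphism of monoids with zero from `B` to an `S`-algebra extends
to `B ⊗_{𝔽₁} S`. -/
noncomputable def lift {D : Type w} [CommSemiring D] [Algebra S D] (g : B →*₀ D) :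
    ScalarExt S B →ₐ[S] D :=
  have key : ∀ f : MonoidAlgebra S B, MonoidAlgebra.lift S D B g (proj f).toMA =
      MonoidAlgebra.lift S D B g f := fun f => by
    conv_rhs => rw [← toMA_proj_add f, map_add]
    simp
  AlgHom.ofLinearMap
    { toFun := fun f => MonoidAlgebra.lift S D B g f.toMA
      map_add' := fun f h => map_add (MonoidAlgebra.lift S D B g) f.toMA h.toMA
      map_smul' := fun s f => map_smul (MonoidAlgebra.lift S D B g) s f.toMA }
    ((key 1).trans (map_one _))
    (fun f h => (key _).trans (map_mul _ _ _))

theorem lift_proj {D : Type w} [CommSemiring D] [Algebra S D] (g : B →*₀ D)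
    (f : MonoidAlgebra S B) : lift (S := S) g (proj f) = MonoidAlgebra.lift S D B g f := by
  change MonoidAlgebra.lift S D B g (proj f).toMA = _
  conv_rhs => rw [← toMA_proj_add f, map_add]
  simp

@[simp] theorem lift_x {D : Type w} [CommSemiring D] [Algebra S D] (g : B →*₀ D) (b : B) :
    lift (S := S) g (x b) = g b := by
  change lift (S := S) g (proj _) = _
  rw [lift_proj]; simp

theorem induction {P : ScalarExt S B → Prop} (f : ScalarExt S B) (zero : P 0)
    (add : ∀ f g, P f → P g → P (f + g)) (single : ∀ (s : S) (b : B), P (s • x b)) : P f := by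
  obtain ⟨f, rfl⟩ := proj_surjective f
  induction f using MonoidAlgebra.induction_linear with
  | zero => exact zero
  | add f g hf hg => rw [proj_add]; exact add _ _ hf hg
  | single b t =>
    have : (MonoidAlgebra.single b t : MonoidAlgebra S B) = t • MonoidAlgebra.single b 1 := by simp
    rw [this, proj_smul]; exact single t b

theorem algHom_ext {D : Type w} [CommSemiring D] [Algebra S D] {φ ψ : ScalarExt S B →ₐ[S] D}
    (h : ∀ b, φ (x b) = ψ (x b)) : φ = ψ := by
  ext f
  induction f using induction with
  | zero => simp
  | add f g hf hg => simp [hf, hg]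
  | single s b => simp [h]

/-- Functoriality of the scalar extension in the monoid. -/
noncomputable def map {C : Type w} [CommMonoidWithZero C] (φ : B →*₀ C) :
    ScalarExt S B →ₐ[S] ScalarExt S C :=
  lift ((x : C →*₀ ScalarExt S C).comp φ)

@[simp] theorem map_x {C : Type w} [CommMonoidWithZero C] (φ : B →*₀ C) (b : B) :
    map (S := S) φ (x b) = x (φ b) := by simp [map]

/-- Delete the monomial term of `b` from `f`. -/
noncomputable def erase (b : B) (f : ScalarExt S B) : ScalarExt S B :=
  ⟨f.coeff.erase b, by
    by_cases h : (0 : B) = b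
    · subst h; simp
    · rw [Finsupp.erase_ne h, f.coeff_zero]⟩

/-- Apply a map preserving zero to all coefficients. -/
noncomputable def mapCoeff {R : Type w} [CommSemiring R] (ν : R → S) (h0 : ν 0 = 0)
    (f : ScalarExt R B) : ScalarExt S B :=
  ⟨f.coeff.mapRange ν h0, by simp [f.coeff_zero, h0]⟩

end basic

end ScalarExt


/-- `φ` exhibits its target as the localization of its source at the powers of `f`; in geometric
terms, `φ` is the open immersion of a principal open subset. This notion is the same for monoids
and for semirings. -/
abbrev IsPrincipalLoc {A : Type u} {A' : Type v} [CommMonoid A] [CommMonoid A'] (f : A)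
    (φ : A → A') : Prop :=
  (Submonoid.powers f).IsLocalizationMap φ

theorem IsPrincipalLoc.exists_pow {A : Type u} {A' : Type v} [CommMonoid A] [CommMonoid A'] {f : A}
    {φ : A →* A'} (hφ : IsPrincipalLoc f φ) {s : A} (hs : IsUnit (φ s)) :
    ∃ (n : ℕ) (t : A), s * t = f ^ n := by
  obtain ⟨u, hu⟩ := hs
  obtain ⟨⟨t, ⟨_, m, rfl⟩⟩, ht⟩ := hφ.surj (↑u⁻¹ : A')
  have : φ (s * t) = φ (f ^ m) := by
    rw [map_mul, ← ht, ← hu, ← mul_assoc, Units.mul_inv, one_mul]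
  obtain ⟨⟨_, n, rfl⟩, hc⟩ := hφ.exists_of_eq this
  refine ⟨n + m, t * f ^ n, ?_⟩
  simp only at hc
  rw [pow_add, ← hc, ← mul_assoc, mul_comm]

/-- A scheme over `𝔽₁`, given by gluing the spectra of monoids with zero along principal open
subsets. The affine patches are indexed by `Chart`, and `i ≤ j` means that patch `i` is a principal
open subset of patch `j`. Two patches contained in a third one meet in a patch, and any two patches
are glued along the union of all the patches that lie below both. -/
structure F1Scheme where
  Chart : Type u
  [preorder : Preorder Chart]
  alg : Chart → Type v
  [monoid : ∀ i, CommMonoidWithZero (alg i)]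
  res : ∀ {i j : Chart}, i ≤ j → (alg j →*₀ alg i)
  res_refl : ∀ (i : Chart) (a : alg i), res (le_refl i) a = a
  res_trans : ∀ {i j l : Chart} (h : i ≤ j) (h' : j ≤ l) (a : alg l),
    res h (res h' a) = res (h.trans h') a
  inter : ∀ {i i' j : Chart} (h : i ≤ j) (h' : i' ≤ j),
    ∃ (b b' : alg j) (m : Chart) (hm : m ≤ i) (_ : m ≤ i'),
      IsPrincipalLoc b (res h) ∧ IsPrincipalLoc b' (res h') ∧
        IsPrincipalLoc (b * b') (res (hm.trans h))

attribute [instance] F1Scheme.preorder F1Scheme.monoid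

/-- Every patch is the spectrum of an integral monoid with zero, or is empty (the spectrum of the
zero monoid, which is allowed as a patch for convenience). -/
class F1Scheme.IsLocallyIntegral (Y : F1Scheme.{u, v}) : Prop where
  cancel : ∀ i, IsCancelMulZero (Y.alg i)

/-- A scheme over a semiring `S`, given by gluing the spectra of `S`-algebras along principal open
subsets, with the same conventions as for schemes over `𝔽₁`. -/
structure SemiringScheme (S : Type w) [CommSemiring S] where
  Chart : Type u
  [preorder : Preorder Chart]
  alg : Chart → Type v
  [semiring : ∀ i, CommSemiring (alg i)]
  [algebra : ∀ i, Algebra S (alg i)]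
  res : ∀ {i j : Chart}, i ≤ j → (alg j →ₐ[S] alg i)
  res_refl : ∀ (i : Chart) (a : alg i), res (le_refl i) a = a
  res_trans : ∀ {i j l : Chart} (h : i ≤ j) (h' : j ≤ l) (a : alg l),
    res h (res h' a) = res (h.trans h') a
  inter : ∀ {i i' j : Chart} (h : i ≤ j) (h' : i' ≤ j),
    ∃ (b b' : alg j) (m : Chart) (hm : m ≤ i) (_ : m ≤ i'),
      IsPrincipalLoc b (res h) ∧ IsPrincipalLoc b' (res h') ∧
        IsPrincipalLoc (b * b') (res (hm.trans h))

attribute [instance] SemiringScheme.preorder SemiringScheme.semiring SemiringScheme.algebra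

namespace SemiringScheme

variable {S : Type w} [CommSemiring S] (Y : SemiringScheme.{u, v, w} S)

theorem exists_principalLoc {i j : Y.Chart} (h : i ≤ j) : ∃ f, IsPrincipalLoc f (Y.res h) := by
  obtain ⟨b, _, _, _, _, hb, _⟩ := Y.inter h h
  exact ⟨b, hb⟩

/-- Two `T`-points of affine patches are identified if they come from a `T`-point of a patch that
lies below both. -/
def PointRel (T : Type*) [CommSemiring T] [Algebra S T] (p q : Σ i, Y.alg i →ₐ[S] T) : Prop :=
  ∃ (l : Y.Chart) (h : l ≤ p.1) (h' : l ≤ q.1) (χ : Y.alg l →ₐ[S] T),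
    χ.comp (Y.res h) = p.2 ∧ χ.comp (Y.res h') = q.2

/-- The set `Y(T)` of morphisms `Spec T ⟶ Y` over `S`, for a local semiring `T`. As every Zariski
covering of `Spec T` contains `Spec T` itself, a `T`-point of `Y` is a `T`-point of an affine
patch, up to gluing. -/
def Points (T : Type*) [CommSemiring T] [Algebra S T] [IsLocalRing T] : Type _ :=
  Quot (Y.PointRel T)

/-- The `T`-point of `Y` given by a `T`-point of an affine patch. -/
def point {T : Type*} [CommSemiring T] [Algebra S T] [IsLocalRing T] (i : Y.Chart)
    (φ : Y.alg i →ₐ[S] T) : Y.Points T :=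
  Quot.mk _ ⟨i, φ⟩

/-- A closed subscheme of a semiring scheme: a quasi-coherent sheaf of congruences, i.e. a
congruence on the algebra of every patch, such that the congruence on a smaller patch is the
localization of the one on a larger patch. -/
structure ClosedSubscheme where
  con : ∀ i, RingCon (Y.alg i)
  quasiCoherent : ∀ {i j : Y.Chart} (h : i ≤ j) (a b : Y.alg j),
    con i (Y.res h a) (Y.res h b) ↔ ∃ s, IsUnit (Y.res h s) ∧ con j (s * a) (s * b)

namespace ClosedSubscheme

variable {Y}

theorem con_res_iff (Z : Y.ClosedSubscheme) {i j : Y.Chart} (h : i ≤ j) {f : Y.alg j}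
    (hf : IsPrincipalLoc f (Y.res h)) (a b : Y.alg j) :
    Z.con i (Y.res h a) (Y.res h b) ↔ ∃ n : ℕ, Z.con j (f ^ n * a) (f ^ n * b) := by
  rw [Z.quasiCoherent]
  constructor
  · rintro ⟨s, hs, hab⟩
    obtain ⟨n, t, hst⟩ := IsPrincipalLoc.exists_pow (φ := (Y.res h : Y.alg j →* Y.alg i)) hf hs
    refine ⟨n, ?_⟩
    rw [← hst, mul_comm s t, mul_assoc, mul_assoc]
    exact (Z.con j).mul ((Z.con j).refl t) hab
  · rintro ⟨n, hn⟩
    exact ⟨f ^ n, hf.map_units ⟨_, n, rfl⟩, hn⟩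

theorem con_res (Z : Y.ClosedSubscheme) {i j : Y.Chart} (h : i ≤ j) {a b : Y.alg j}
    (hab : Z.con j a b) : Z.con i (Y.res h a) (Y.res h b) :=
  (Z.quasiCoherent h a b).2 ⟨1, by simp, by simpa using hab⟩

/-- Restriction between the affine patches of a closed subscheme. -/
noncomputable def resQuot (Z : Y.ClosedSubscheme) {i j : Y.Chart} (h : i ≤ j) :
    (Z.con j).Quotient →ₐ[S] (Z.con i).Quotient where
  toRingHom := (Z.con j).lift ((Z.con i).mk'.comp (Y.res h : Y.alg j →+* Y.alg i))
    (fun _ _ hab => (Z.con i).eq.2 (Z.con_res h hab))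
  commutes' s := by
    change (((Y.res h) (algebraMap S _ s) : Y.alg i) : (Z.con i).Quotient) = _
    rw [AlgHom.commutes]; rfl

theorem resQuot_coe (Z : Y.ClosedSubscheme) {i j : Y.Chart} (h : i ≤ j) (a : Y.alg j) :
    Z.resQuot h (a : (Z.con j).Quotient) = (Y.res h a : (Z.con i).Quotient) := rfl

theorem isPrincipalLoc_resQuot (Z : Y.ClosedSubscheme) {i j : Y.Chart} (h : i ≤ j) {f : Y.alg j}
    (hf : IsPrincipalLoc f (Y.res h)) :
    IsPrincipalLoc (f : (Z.con j).Quotient) (Z.resQuot h) where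
  map_units := by
    rintro ⟨_, n, rfl⟩
    exact (hf.map_units ⟨_, n, rfl⟩).map (Z.con i).mk'
  surj z := by
    induction z using Quotient.inductionOn with | _ z =>
    obtain ⟨⟨a, ⟨_, n, rfl⟩⟩, ha⟩ := hf.surj z
    exact ⟨⟨a, ⟨_, n, rfl⟩⟩, congrArg (Z.con i).mk' ha⟩
  exists_of_eq {a b} hab := by
    induction a using Quotient.inductionOn with | _ a =>
    induction b using Quotient.inductionOn with | _ b =>
    obtain ⟨n, hn⟩ := (Z.con_res_iff h hf a b).1 ((Z.con i).eq.1 hab)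
    exact ⟨⟨_, n, rfl⟩, (Z.con j).eq.2 hn⟩

/-- A closed subscheme, regarded as a scheme over `S`. -/
noncomputable abbrev toScheme (Z : Y.ClosedSubscheme) : SemiringScheme.{u, v, w} S where
  Chart := Y.Chart
  alg i := (Z.con i).Quotient
  res h := Z.resQuot h
  res_refl i a := by
    induction a using Quotient.inductionOn with | _ a =>
    exact congrArg (Z.con i).mk' (Y.res_refl i a)
  res_trans {i _ _} h h' a := by
    induction a using Quotient.inductionOn with | _ a =>
    exact congrArg (Z.con i).mk' (Y.res_trans h h' a)
  inter h h' := by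
    obtain ⟨b, b', m, hm, hm', hb, hb', hbb'⟩ := Y.inter h h'
    exact ⟨b, b', m, hm, hm', Z.isPrincipalLoc_resQuot h hb, Z.isPrincipalLoc_resQuot h' hb',
      Z.isPrincipalLoc_resQuot _ hbb'⟩

/-- The quotient map onto the algebra of an affine patch of a closed subscheme. -/
noncomputable def quotMap (Z : Y.ClosedSubscheme) (i : Y.Chart) :
    Y.alg i →ₐ[S] (Z.con i).Quotient :=
  { (Z.con i).mk' with commutes' := fun _ => rfl }

/-- The inclusion of `Z(T)` into `Y(T)`. -/
noncomputable def incl (Z : Y.ClosedSubscheme) (T : Type*) [CommSemiring T] [Algebra S T]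
    [IsLocalRing T] : Z.toScheme.Points T → Y.Points T :=
  Quot.map (fun p => ⟨p.1, p.2.comp (Z.quotMap p.1)⟩) (by
    rintro p q ⟨l, h, h', χ, hp, hq⟩
    exact ⟨l, h, h', χ.comp (Z.quotMap l),
      congrArg (fun θ => AlgHom.comp θ (Z.quotMap p.1)) hp,
      congrArg (fun θ => AlgHom.comp θ (Z.quotMap q.1)) hq⟩)

/-- The subset `Z(T)` of `Y(T)`. -/
def points (Z : Y.ClosedSubscheme) (T : Type*) [CommSemiring T] [Algebra S T] [IsLocalRing T] :
    Set (Y.Points T) :=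
  Set.range (Z.incl T)

end ClosedSubscheme

/-- The strong Zariski topology on `Y(S)`, in which the sets `Z(S)` are closed for all closed
subschemes `Z` of `Y`. -/
instance strongZariski [IsLocalRing S] : TopologicalSpace (Y.Points S) :=
  TopologicalSpace.generateFrom {O | ∃ Z : Y.ClosedSubscheme, O = (Z.points S)ᶜ}

end SemiringScheme

namespace ScalarExt

section localization

variable {S : Type u} [CommSemiring S] {B : Type v} [CommMonoidWithZero B]
  {C : Type w} [CommMonoidWithZero C]

theorem isPrincipalLoc_map {φ : B →*₀ C} {b : B} (hφ : IsPrincipalLoc b φ) :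
    IsPrincipalLoc (x b : ScalarExt S B) (map (S := S) φ) where
  map_units := by
    rintro ⟨_, n, rfl⟩
    have := (hφ.map_units ⟨_, 1, rfl⟩).map (x : C →*₀ ScalarExt S C)
    simpa using this.pow n
  surj z := by
    suffices ∃ (n : ℕ) (f : ScalarExt S B), z * map φ (x b ^ n) = map φ f by
      obtain ⟨n, f, h⟩ := this
      exact ⟨⟨f, ⟨_, n, rfl⟩⟩, h⟩
    induction z using induction with
    | zero => exact ⟨0, 0, by simp⟩
    | add f g hf hg =>
      obtain ⟨n, f', hf⟩ := hf
      obtain ⟨m, g', hg⟩ := hg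
      refine ⟨n + m, f' * x b ^ m + g' * x b ^ n, ?_⟩
      rw [map_add, map_mul, map_mul, ← hf, ← hg, pow_add, map_mul]
      ring
    | single s c =>
      obtain ⟨⟨a, ⟨_, n, rfl⟩⟩, ha⟩ := hφ.surj c
      refine ⟨n, s • x a, ?_⟩
      simp only at ha
      rw [map_smul, map_x, ← ha, map_mul, map_pow, map_pow, map_pow, map_x, smul_mul_assoc]
  exists_of_eq {f g} hfg := by
    let L := Localization.Away (x b : ScalarExt S B)
    let ι : B →*₀ L := (algebraMap (ScalarExt S B) L).toMonoidWithZeroHom.comp x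
    let loc : (Submonoid.powers b).LocalizationMap C :=
      { toFun := φ, map_mul' := map_mul φ, isLocalizationMap := hφ }
    have hι : ∀ y : Submonoid.powers b, IsUnit ((ι : B →* L) y) := by
      rintro ⟨_, n, rfl⟩
      have : IsUnit (algebraMap (ScalarExt S B) L (x b)) :=
        IsLocalization.map_units L ⟨x b, Submonoid.mem_powers _⟩
      have h2 := this.pow n
      rw [← map_pow, ← map_pow] at h2
      exact h2
    have hlift : ∀ a, loc.lift hι (φ a) = ι a := fun a => loc.lift_eq hι a
    let ψ : C →*₀ L :=
      { loc.lift hι with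
        map_zero' := by
          have := hlift 0
          simpa using this }
    have key : ∀ f, lift (S := S) ψ (map φ f) = algebraMap (ScalarExt S B) L f := by
      intro f
      have : (lift (S := S) ψ).comp (map φ) = IsScalarTower.toAlgHom S (ScalarExt S B) L :=
        algHom_ext fun a => by
          change lift (S := S) ψ (map φ (x a)) = algebraMap (ScalarExt S B) L (x a)
          rw [map_x, lift_x]
          exact hlift a
      exact congrArg (fun θ => θ f) this
    have : algebraMap (ScalarExt S B) L f = algebraMap (ScalarExt S B) L g := by
      rw [← key, ← key, hfg]
    exact (IsLocalization.eq_iff_exists (Submonoid.powers (x b : ScalarExt S B)) L).1 this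

end localization

end ScalarExt

/-- The base change `Y ×_{𝔽₁} S` of a scheme over `𝔽₁`. -/
noncomputable abbrev F1Scheme.baseChange (Y : F1Scheme.{u, v}) (S : Type w) [CommSemiring S] :
    SemiringScheme.{u, max v w, w} S where
  Chart := Y.Chart
  alg i := ScalarExt S (Y.alg i)
  res h := ScalarExt.map (Y.res h)
  res_refl i a := by
    have : ScalarExt.map (S := S) (Y.res (le_refl i)) = AlgHom.id S _ :=
      ScalarExt.algHom_ext fun b => by simp [Y.res_refl]
    exact congrArg (fun θ => θ a) this
  res_trans {i j l} h h' a := by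
    have : (ScalarExt.map (S := S) (Y.res h)).comp (ScalarExt.map (Y.res h')) =
        ScalarExt.map (Y.res (h.trans h')) :=
      ScalarExt.algHom_ext fun b => by simp [Y.res_trans]
    exact congrArg (fun θ => θ a) this
  inter h h' := by
    obtain ⟨b, b', m, hm, hm', hb, hb', hbb'⟩ := Y.inter h h'
    refine ⟨ScalarExt.x b, ScalarExt.x b', m, hm, hm', ScalarExt.isPrincipalLoc_map hb,
      ScalarExt.isPrincipalLoc_map hb', ?_⟩
    rw [← map_mul]
    exact ScalarExt.isPrincipalLoc_map hbb'


namespace ScalarExt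

section tropical

variable {R : Type*} [CommRing R] {S : Type*} [CommSemiring S] {B : Type*} [CommMonoidWithZero B]
  {C : Type*} [CommMonoidWithZero C]

/-- Relabel the monomials along an injective map preserving zero. -/
noncomputable def relabel (h : B → C) (hi : Function.Injective h) (h0 : h 0 = 0)
    (f : ScalarExt S B) : ScalarExt S C :=
  ⟨f.coeff.mapDomain h, by
    rw [← h0, Finsupp.mapDomain_apply hi, f.coeff_zero]⟩

theorem map_eq_relabel (φ : B →*₀ C) (hi : Function.Injective φ) (f : ScalarExt S B) :
    map φ f = relabel φ hi (map_zero φ) f := by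
  induction f using induction with
  | zero => ext c; simp [relabel, zero_coeff]
  | add f g hf hg =>
    rw [map_add, hf, hg]
    ext c
    simp [relabel, coeff_add, Finsupp.mapDomain_add]
  | single s b =>
    rw [map_smul, map_x]
    by_cases hb : b = 0
    · subst hb
      ext c
      simp [relabel, coeff_smul, x, proj]
    · have hb' : φ b ≠ 0 := fun h => hb (hi (h.trans (map_zero φ).symm))
      ext c
      simp [relabel, coeff_smul, x, proj, hb, hb', Finsupp.mapDomain_single]

theorem x_mul_eq_relabel (b : B) (hi : Function.Injective (b * ·)) (f : ScalarExt S B) :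
    x b * f = relabel (b * ·) hi (mul_zero b) f := by
  induction f using induction with
  | zero => ext c; simp [relabel, zero_coeff]
  | add f g hf hg =>
    rw [mul_add, hf, hg]
    ext c
    simp [relabel, coeff_add, Finsupp.mapDomain_add]
  | single s a =>
    rw [mul_smul_comm, ← map_mul]
    by_cases ha : a = 0
    · subst ha
      ext c
      simp [relabel, coeff_smul, x, proj]
    · have ha' : b * a ≠ 0 := fun h => ha (hi (h.trans (mul_zero b).symm))
      ext c
      simp [relabel, coeff_smul, x, proj, ha, ha', Finsupp.mapDomain_single]

theorem relabel_erase (h : B → C) (hi : Function.Injective h) (h0 : h 0 = 0) (b : B)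
    (f : ScalarExt S B) : relabel h hi h0 (erase b f) = erase (h b) (relabel h hi h0 f) := by
  ext c
  by_cases hc : c ∈ Set.range h
  · obtain ⟨a, rfl⟩ := hc
    by_cases hab : a = b
    · subst hab; simp [relabel, erase, Finsupp.mapDomain_apply hi]
    · simp [relabel, erase, Finsupp.mapDomain_apply hi, Finsupp.erase_ne hab,
        Finsupp.erase_ne (hi.ne hab)]
  · have hcb : c ≠ h b := fun e => hc ⟨b, e.symm⟩
    simp [relabel, erase, Finsupp.mapDomain_of_notMem_range _ _ hc, Finsupp.erase_ne hcb]

theorem relabel_mapCoeff (ν : R → S) (ν0 : ν 0 = 0) (h : B → C) (hi : Function.Injective h)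
    (h0 : h 0 = 0) (f : ScalarExt R B) :
    relabel h hi h0 (mapCoeff ν ν0 f) = mapCoeff ν ν0 (relabel h hi h0 f) := by
  ext c
  by_cases hc : c ∈ Set.range h
  · obtain ⟨a, rfl⟩ := hc
    simp [relabel, mapCoeff, Finsupp.mapDomain_apply hi]
  · simp [relabel, mapCoeff, Finsupp.mapDomain_of_notMem_range _ _ hc, ν0]

/-- The tropicalization of an ideal `I`: the `S`-linear span of the coefficientwise valuations of
the elements of `I`. -/
noncomputable def trop (ν : SemiringValuation R S) (I : Set (ScalarExt R B)) :
    Submodule S (ScalarExt S B) :=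
  Submodule.span S (mapCoeff ν.toFun ν.map_zero '' I)

/-- The congruence generated by the bend relations `f ∼ f - (term of b)` for `f ∈ J` and for
monomials `b`. (If `b` does not occur in `f`, the relation is trivial.) -/
noncomputable def bend (J : Submodule S (ScalarExt S B)) : RingCon (ScalarExt S B) :=
  ringConGen fun p q => ∃ f ∈ J, ∃ b, p = f ∧ q = erase b f

end tropical

end ScalarExt

namespace RingCon

/-- The localization of a congruence. -/
def localize {A A' : Type*} [CommSemiring A] [CommSemiring A'] (c : RingCon A) (φ : A →+* A')
    {f : A} (hφ : IsPrincipalLoc f φ) : RingCon A' where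
  r y z := ∃ (s a b : A), IsUnit (φ s) ∧ φ s * y = φ a ∧ φ s * z = φ b ∧ c a b
  iseqv :=
    { refl := fun y => by
        obtain ⟨⟨a, s⟩, h⟩ := hφ.surj y
        exact ⟨s, a, a, hφ.map_units s, by rw [mul_comm]; exact h, by rw [mul_comm]; exact h,
          c.refl a⟩
      symm := fun ⟨s, a, b, hs, ha, hb, hab⟩ => ⟨s, b, a, hs, hb, ha, c.symm hab⟩
      trans := by
        rintro y z w ⟨s, a, b, hs, ha, hb, hab⟩ ⟨s', b', d, hs', hb', hd, hbd⟩
        have : φ (s' * b) = φ (s * b') := by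
          rw [map_mul, map_mul, ← hb, ← hb']; ring
        obtain ⟨t, ht⟩ := hφ.exists_of_eq this
        refine ⟨t * (s * s'), t * (s' * a), t * (s * d), ?_, ?_, ?_, ?_⟩
        · rw [map_mul, map_mul]; exact (hφ.map_units t).mul (hs.mul hs')
        · simp only [map_mul]; rw [← ha]; ring
        · simp only [map_mul]; rw [← hd]; ring
        · refine c.trans (c.mul (c.refl _) (c.mul (c.refl _) hab)) ?_
          rw [ht]
          exact c.mul (c.refl _) (c.mul (c.refl _) hbd) }
  add' := by
    rintro y z y' z' ⟨s, a, b, hs, ha, hb, hab⟩ ⟨s', a', b', hs', ha', hb', hab'⟩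
    refine ⟨s * s', s' * a + s * a', s' * b + s * b', ?_, ?_, ?_, ?_⟩
    · rw [map_mul]; exact hs.mul hs'
    · simp only [map_mul, map_add]; rw [← ha, ← ha']; ring
    · simp only [map_mul, map_add]; rw [← hb, ← hb']; ring
    · exact c.add (c.mul (c.refl _) hab) (c.mul (c.refl _) hab')
  mul' := by
    rintro y z y' z' ⟨s, a, b, hs, ha, hb, hab⟩ ⟨s', a', b', hs', ha', hb', hab'⟩
    refine ⟨s * s', a * a', b * b', ?_, ?_, ?_, ?_⟩
    · rw [map_mul]; exact hs.mul hs'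
    · simp only [map_mul]; rw [← ha, ← ha']; ring
    · simp only [map_mul]; rw [← hb, ← hb']; ring
    · exact c.mul hab hab'

end RingCon

namespace F1Scheme

open ScalarExt

variable {R : Type*} [CommRing R] {S : Type*} [CommSemiring S]

theorem trop_localize {B C : Type*} [CommMonoidWithZero B] [CommMonoidWithZero C]
    [IsCancelMulZero B] (ν : SemiringValuation R S) (φ : B →*₀ C)
    {b : B} (hφ : IsPrincipalLoc b φ) (I : Set (ScalarExt R B)) (I' : Set (ScalarExt R C))
    (hmul : ∀ f ∈ I, ∀ g, g * f ∈ I)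
    (hI : ∀ f, map φ f ∈ I' ↔ ∃ n : ℕ, x b ^ n * f ∈ I)
    (hmul' : ∀ f ∈ I', ∀ g, g * f ∈ I') (f g : ScalarExt S B) :
    bend (trop ν I') (map φ f) (map φ g) ↔
      ∃ s, IsUnit (map (S := S) φ s) ∧ bend (trop ν I) (s * f) (s * g) := by
  have hloc := isPrincipalLoc_map (S := S) hφ
  by_cases hb : b = 0
  · subst hb
    have h0 : IsUnit (0 : ScalarExt S C) := by
      have := hloc.map_units ⟨_, 1, rfl⟩
      simpa using this
    have : Subsingleton (ScalarExt S C) := isUnit_zero_iff.1 h0 |> subsingleton_of_zero_eq_one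
    constructor
    · intro _
      exact ⟨0, by simpa using h0, by simpa using (bend (trop ν I)).refl 0⟩
    · intro _
      rw [Subsingleton.elim (map φ f) (map φ g)]
      exact (bend (trop ν I')).refl _
  have hpow : ∀ n : ℕ, Function.Injective ((b ^ n) * · : B → B) := fun n =>
    mul_right_injective₀ (pow_ne_zero n hb)
  have hi : Function.Injective φ := fun a a' h => by
    obtain ⟨⟨_, n, rfl⟩, hn⟩ := hφ.exists_of_eq h
    exact hpow n hn
  have hu : ∀ n : ℕ, IsUnit (φ b ^ n) := fun n => by
    simpa using hφ.map_units ⟨_, n, rfl⟩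
  have hpow' : ∀ n : ℕ, Function.Injective ((φ b ^ n) * · : C → C) := fun n =>
    (hu n).mul_right_injective
  -- the tropicalized ideals are stable under multiplication by powers of `x b`
  have hstab : ∀ (n : ℕ), ∀ p ∈ trop ν I, x b ^ n * p ∈ trop ν I := by
    intro n p hp
    induction hp using Submodule.span_induction with
    | mem p hp =>
      obtain ⟨h, hh, rfl⟩ := hp
      refine Submodule.subset_span ⟨x b ^ n * h, hmul h hh _, ?_⟩
      rw [← map_pow, ← map_pow, x_mul_eq_relabel _ (hpow n), x_mul_eq_relabel _ (hpow n),
        relabel_mapCoeff]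
    | zero => rw [mul_zero]; exact Submodule.zero_mem _
    | add p q _ _ hp hq => rw [mul_add]; exact Submodule.add_mem _ hp hq
    | smul s p _ hp => rw [mul_smul_comm]; exact Submodule.smul_mem _ _ hp
  have hres : ∀ p ∈ trop ν I, map φ p ∈ trop ν I' := by
    intro p hp
    induction hp using Submodule.span_induction with
    | mem p hp =>
      obtain ⟨h, hh, rfl⟩ := hp
      refine Submodule.subset_span ⟨map φ h, (hI h).2 ⟨0, by simpa using hh⟩, ?_⟩
      rw [map_eq_relabel _ hi, map_eq_relabel _ hi, relabel_mapCoeff]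
    | zero => rw [map_zero]; exact Submodule.zero_mem _
    | add p q _ _ hp hq => rw [map_add]; exact Submodule.add_mem _ hp hq
    | smul s p _ hp => rw [map_smul]; exact Submodule.smul_mem _ _ hp
  have hlift : ∀ p ∈ trop ν I', ∃ (n : ℕ), ∃ q ∈ trop ν I, map φ (x b ^ n) * p = map φ q := by
    intro p hp
    induction hp using Submodule.span_induction with
    | mem p hp =>
      obtain ⟨h, hh, rfl⟩ := hp
      obtain ⟨⟨h', ⟨_, n, rfl⟩⟩, hn⟩ := (isPrincipalLoc_map (S := R) hφ).surj h
      simp only at hn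
      obtain ⟨m, hm⟩ := (hI h').1 (by rw [← hn, mul_comm]; exact hmul' h hh _)
      refine ⟨n + m, _, Submodule.subset_span ⟨_, hm, rfl⟩, ?_⟩
      have e : map φ (x b ^ m * h') = x (φ b ^ (n + m)) * h := by
        rw [map_mul, ← hn]; simp only [map_pow, map_x]; ring
      rw [map_eq_relabel φ hi (mapCoeff _ _ _), relabel_mapCoeff, ← map_eq_relabel φ hi, e,
        x_mul_eq_relabel _ (hpow' _), ← relabel_mapCoeff, ← x_mul_eq_relabel]
      simp only [map_pow, map_x]
    | zero => exact ⟨0, 0, Submodule.zero_mem _, by simp⟩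
    | add p q _ _ hp hq =>
      obtain ⟨n, p', hp', hp⟩ := hp
      obtain ⟨m, q', hq', hq⟩ := hq
      refine ⟨n + m, x b ^ m * p' + x b ^ n * q',
        Submodule.add_mem _ (hstab _ _ hp') (hstab _ _ hq'), ?_⟩
      rw [map_add, map_mul, map_mul, ← hp, ← hq, pow_add, map_mul]
      ring
    | smul s p _ hp =>
      obtain ⟨n, p', hp', hp⟩ := hp
      exact ⟨n, s • p', Submodule.smul_mem _ _ hp', by rw [mul_smul_comm, hp, map_smul]⟩
  constructor
  · intro hfg
    have hle : bend (trop ν I') ≤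
        (bend (trop ν I)).localize (map (S := S) φ : ScalarExt S B →+* ScalarExt S C) hloc := by
      refine RingCon.ringConGen_le.2 ?_
      rintro p _ ⟨_, hp, c, rfl, rfl⟩
      obtain ⟨n, q, hq, hn⟩ := hlift p hp
      obtain ⟨⟨c', ⟨_, m, rfl⟩⟩, hm⟩ := hφ.surj c
      simp only at hm
      refine ⟨x b ^ (n + m), x b ^ m * q, erase (b ^ n * c') (x b ^ m * q), ?_, ?_, ?_, ?_⟩
      · exact hloc.map_units ⟨_, n + m, rfl⟩
      · change map φ (x b ^ (n + m)) * p = map φ (x b ^ m * q)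
        rw [map_mul, ← hn, pow_add, map_mul]; ring
      · change map φ (x b ^ (n + m)) * erase c p = map φ (erase _ (x b ^ m * q))
        have e1 : map φ (x b ^ m * q) = x (φ b ^ (n + m)) * p := by
          rw [map_mul, ← hn]; simp only [map_pow, map_x]; ring
        have e2 : φ (b ^ n * c') = φ b ^ (n + m) * c := by
          rw [map_mul, ← hm]; simp only [map_pow]
          rw [pow_add, mul_comm c, mul_assoc]
        rw [map_eq_relabel φ hi (erase _ _), relabel_erase, ← map_eq_relabel φ hi, e1, e2,
          map_pow, map_x, ← map_pow, x_mul_eq_relabel _ (hpow' _), x_mul_eq_relabel _ (hpow' _),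
          relabel_erase]
      · exact RingConGen.Rel.of _ _ ⟨_, hstab m q hq, _, rfl, rfl⟩
    obtain ⟨s, a, a', hs, ha, ha', haa'⟩ := hle hfg
    change IsUnit (map φ s) at hs
    change map φ s * map φ f = map φ a at ha
    change map φ s * map φ g = map φ a' at ha'
    rw [← map_mul] at ha ha'
    obtain ⟨t, ht⟩ := hloc.exists_of_eq ha
    obtain ⟨t', ht'⟩ := hloc.exists_of_eq ha'
    refine ⟨t * t' * s, ?_, ?_⟩
    · rw [map_mul, map_mul]
      exact ((hloc.map_units t).mul (hloc.map_units t')).mul hs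
    · have e1 : (t : ScalarExt S B) * t' * s * f = t' * t * a := by
        rw [mul_assoc (t' : ScalarExt S B), ← ht]; ring
      have e2 : (t : ScalarExt S B) * t' * s * g = t' * t * a' := by
        rw [mul_comm (t' : ScalarExt S B), mul_assoc (t : ScalarExt S B) t' a', ← ht']; ring
      rw [e1, e2]
      exact (bend (trop ν I)).mul ((bend (trop ν I)).refl _) haa'
  · rintro ⟨s, hs, hfg⟩
    have hle : bend (trop ν I) ≤
        (bend (trop ν I')).comap (map (S := S) φ : ScalarExt S B →+* ScalarExt S C) := by
      refine RingCon.ringConGen_le.2 ?_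
      rintro p _ ⟨_, hp, c, rfl, rfl⟩
      refine RingConGen.Rel.of _ _ ⟨map φ p, hres p hp, φ c, rfl, ?_⟩
      change map φ (erase c p) = _
      rw [map_eq_relabel φ hi, map_eq_relabel φ hi, relabel_erase]
    have h1 : bend (trop ν I') (map φ (s * f)) (map φ (s * g)) := hle hfg
    rw [map_mul (map φ), map_mul (map φ)] at h1
    obtain ⟨w, hw⟩ := hs
    have h2 := (bend (trop ν I')).mul ((bend (trop ν I')).refl (↑w⁻¹ : ScalarExt S C)) h1
    rwa [← hw, ← mul_assoc, ← mul_assoc, Units.inv_mul, one_mul, one_mul] at h2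


/-- The scheme-theoretic tropicalization of a closed subscheme `X` of `Y ×_{𝔽₁} R` for a locally
integral scheme `Y` over `𝔽₁`: the closed subscheme of `Y ×_{𝔽₁} S` that is cut out on every patch
by the bend relations of the tropicalization of the ideal of `X`. -/
noncomputable def tropicalization (Y : F1Scheme.{u, v}) [hY : Y.IsLocallyIntegral]
    (ν : SemiringValuation R S) (X : (Y.baseChange R).ClosedSubscheme) :
    (Y.baseChange S).ClosedSubscheme where
  con i := bend (trop ν {f : ScalarExt R (Y.alg i) | X.con i f 0})
  quasiCoherent {i j} h a b := by
    have := hY.cancel j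
    obtain ⟨b₀, _, _, _, _, hb₀, _⟩ := Y.inter h h
    have hmul : ∀ (l : Y.Chart) (f : ScalarExt R (Y.alg l)), X.con l f 0 →
        ∀ g, X.con l (g * f) 0 := fun l f hf g => by
      have := (X.con l).mul ((X.con l).refl g) hf
      rwa [mul_zero] at this
    refine trop_localize ν (Y.res h) hb₀ _ _ (hmul j) (fun f => ?_) (hmul i) a b
    have := X.con_res_iff h (isPrincipalLoc_map (S := R) hb₀) f 0
    rw [map_zero] at this
    refine this.trans (exists_congr fun n => ?_)
    rw [mul_zero]; rfl

/-- The maximum of a family of tropical numbers is `-∞` or is attained at least twice. -/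
def MaxAttainedTwice {ι : Type*} (t : ι → TropicalReal) : Prop :=
  (∀ b, t b = 0) ∨ ∃ b b', b ≠ b' ∧ t b = t b' ∧ ∀ c, t c ≤ t b

/-- The set-theoretic tropicalization of a closed subscheme `X` of `Y ×_{𝔽₁} R`: the set of those
tropical points `q` of `Y ×_{𝔽₁} 𝕋` such that, for every `∑ λ_b x_b` in the ideal of `X`, the
maximum of the `q (ν(λ_b) x_b)` is `-∞` or is attained at least twice. -/
def setTropicalization (Y : F1Scheme.{u, v}) (ν : SemiringValuation R TropicalReal)
    (X : (Y.baseChange R).ClosedSubscheme) : Set ((Y.baseChange TropicalReal).Points TropicalReal) :=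
  {p | ∃ (i : Y.Chart) (q : ScalarExt TropicalReal (Y.alg i) →ₐ[TropicalReal] TropicalReal),
    p = (Y.baseChange TropicalReal).point i q ∧
    ∀ f : ScalarExt R (Y.alg i), X.con i f 0 →
      MaxAttainedTwice fun b => q (ν.toFun (f.coeff b) • x b)}

end F1Scheme

namespace AlgebraicGeometry.Scheme

variable (X : Scheme.{u}) (𝒰 : Set X.affineOpens)

/-- The principal open subsets of the members of an affine open covering `𝒰`. -/
def PrincipalChart : Type u :=
  {V : X.Opens // ∃ U ∈ 𝒰, ∃ f : Γ(X, U.1), V = X.basicOpen f}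

variable {X 𝒰}

theorem PrincipalChart.isAffineOpen (V : X.PrincipalChart 𝒰) : IsAffineOpen V.1 := by
  obtain ⟨V, U, hU, f, rfl⟩ := V
  exact U.2.basicOpen f

/-- The order in which `V ≤ W` means that `V` is a principal open subset of `W`. -/
instance : Preorder (X.PrincipalChart 𝒰) where
  le V W := ∃ f : Γ(X, W.1), V.1 = X.basicOpen f
  le_refl V := ⟨1, by simp⟩
  le_trans := by
    rintro ⟨_, hV⟩ ⟨_, hW⟩ U ⟨g, h⟩ ⟨f, h'⟩
    dsimp only at g h h' 
    subst h'
    obtain ⟨f', hf'⟩ := U.isAffineOpen.basicOpen_basicOpen_is_basicOpen f g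
    exact ⟨f', h.trans hf'.symm⟩

theorem PrincipalChart.le_opens {V W : X.PrincipalChart 𝒰} (h : V ≤ W) : V.1 ≤ W.1 := by
  obtain ⟨f, hf⟩ := h
  rw [hf]; exact X.basicOpen_le f

theorem PrincipalChart.isPrincipalLoc {V W : X.PrincipalChart 𝒰} (h : V.1 ≤ W.1) {f : Γ(X, W.1)}
    (hf : V.1 = X.basicOpen f) :
    IsPrincipalLoc f ((X.presheaf.map (homOfLE h).op).hom) := by
  let := (X.presheaf.map (homOfLE h).op).hom.toAlgebra
  exact (isLocalization_iff_isLocalizationMap _ _).1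
    (W.isAffineOpen.isLocalization_of_eq_basicOpen f (homOfLE h) hf)

variable (X 𝒰)

/-- The scalar restriction `M(X)` of a scheme `X` to `𝔽₁`, formed with the affine open covering
`𝒰`: the coordinate rings of the members of `𝒰` and of their principal open subsets are replaced by
their multiplicative monoids, and these are glued as in `X`. -/
noncomputable abbrev scalarRestriction : F1Scheme.{u, u} where
  Chart := X.PrincipalChart 𝒰
  alg V := Γ(X, V.1)
  res h := ((X.presheaf.map (homOfLE (PrincipalChart.le_opens h)).op).hom).toMonoidWithZeroHom
  res_refl V a := by
    change (X.presheaf.map (𝟙 _)) a = a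
    simp
  res_trans h h' a := by
    change (X.presheaf.map _ ≫ X.presheaf.map _) a = (X.presheaf.map _) a
    rw [← X.presheaf.map_comp]
    rfl
  inter {V V' W} h h' := by
    obtain ⟨f, hf⟩ := id h
    obtain ⟨f', hf'⟩ := id h'
    obtain ⟨U, hU, g, hg⟩ := W.2
    let m : X.PrincipalChart 𝒰 := ⟨X.basicOpen (f * f'), by
      obtain ⟨W, hW⟩ := W
      dsimp only at hg f f'
      subst hg
      obtain ⟨g', hg'⟩ := U.2.basicOpen_basicOpen_is_basicOpen g (f * f')
      exact ⟨U, hU, g', hg'.symm⟩⟩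
    have hmV : m ≤ V := ⟨X.presheaf.map (homOfLE (PrincipalChart.le_opens h)).op f', by
      change X.basicOpen (f * f') = _
      rw [Scheme.basicOpen_mul, Scheme.basicOpen_res, hf]⟩
    have hmV' : m ≤ V' := ⟨X.presheaf.map (homOfLE (PrincipalChart.le_opens h')).op f, by
      change X.basicOpen (f * f') = _
      rw [Scheme.basicOpen_mul, Scheme.basicOpen_res, hf', inf_comm]⟩
    exact ⟨f, f', m, hmV, hmV', PrincipalChart.isPrincipalLoc _ hf,
      PrincipalChart.isPrincipalLoc _ hf', PrincipalChart.isPrincipalLoc _ rfl⟩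

instance [IsIntegral X] : (X.scalarRestriction 𝒰).IsLocallyIntegral where
  cancel V := by
    by_cases h : Nonempty V.1
    · have : IsDomain Γ(X, V.1) := inferInstance
      exact inferInstanceAs (IsCancelMulZero Γ(X, V.1))
    · have hV : V.1 = ⊥ := by
        ext y
        exact ⟨fun hy => (h ⟨⟨y, hy⟩⟩).elim, fun hy => hy.elim⟩
      have : Subsingleton Γ(X, V.1) := by rw [hV]; infer_instance
      refine @IsCancelMulZero.mk Γ(X, V.1) _ _ ?_ ?_
      exacts [⟨fun _ _ _ _ => Subsingleton.elim (α := Γ(X, V.1)) _ _⟩,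
        ⟨fun _ _ _ _ => Subsingleton.elim (α := Γ(X, V.1)) _ _⟩]

variable {X} {k : Type u} [Field k] (π : X ⟶ Spec (CommRingCat.of k))

/-- The scalars of a `k`-scheme as functions on an open subset. -/
noncomputable def scalars (U : X.Opens) : k →+* Γ(X, U) :=
  ((Scheme.ΓSpecIso (CommRingCat.of k)).inv ≫ π.appLE ⊤ U (by simp)).hom

theorem map_scalars {U V : X.Opens} (h : V ≤ U) (c : k) :
    X.presheaf.map (homOfLE h).op (scalars π U c) = scalars π V c := by
  have := π.appLE_map (U := ⊤) (V := U) (V' := V) (by simp) (homOfLE h).op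
  exact congrArg (fun θ => ((Scheme.ΓSpecIso (CommRingCat.of k)).inv ≫ θ) c) this

/-- The evaluation map `∑ λ_a x_a ↦ ∑ λ_a a` from `M(A) ⊗_{𝔽₁} k` to `A`, for the ring `A` of
functions on `U`. -/
noncomputable def ev (U : X.Opens) : ScalarExt k Γ(X, U) →+* Γ(X, U) :=
  letI : Algebra k Γ(X, U) := (scalars π U).toAlgebra
  (ScalarExt.lift (S := k) (MonoidWithZeroHom.id Γ(X, U))).toRingHom

theorem ev_x (U : X.Opens) (a : Γ(X, U)) : ev π U (ScalarExt.x a) = a := by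
  let : Algebra k Γ(X, U) := (scalars π U).toAlgebra
  exact ScalarExt.lift_x _ _

theorem ev_smul (U : X.Opens) (c : k) (f : ScalarExt k Γ(X, U)) :
    ev π U (c • f) = scalars π U c * ev π U f := by
  let : Algebra k Γ(X, U) := (scalars π U).toAlgebra
  exact (map_smul (ScalarExt.lift (S := k) (MonoidWithZeroHom.id Γ(X, U))) c f).trans
    (Algebra.smul_def _ _)

theorem ev_map {U V : X.Opens} (h : V ≤ U) (f : ScalarExt k Γ(X, U)) :
    ev π V (ScalarExt.map ((X.presheaf.map (homOfLE h).op).hom).toMonoidWithZeroHom f) =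
      X.presheaf.map (homOfLE h).op (ev π U f) := by
  induction f using ScalarExt.induction with
  | zero => simp
  | add f g hf hg => simp only [map_add, hf, hg]
  | single c a =>
    rw [map_smul, ScalarExt.map_x, ev_smul, ev_smul, ev_x, ev_x, map_mul, map_scalars]
    rfl

theorem ev_localize {V W : X.PrincipalChart 𝒰} (h : V ≤ W) (a b : ScalarExt k Γ(X, W.1)) :
    let φ := ((X.presheaf.map (homOfLE (PrincipalChart.le_opens h)).op).hom).toMonoidWithZeroHom
    ev π V.1 (ScalarExt.map φ a) = ev π V.1 (ScalarExt.map φ b) ↔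
      ∃ s, IsUnit (ScalarExt.map (S := k) φ s) ∧ ev π W.1 (s * a) = ev π W.1 (s * b) := by
  intro φ
  have hev : ∀ f, ev π V.1 (ScalarExt.map φ f) = φ (ev π W.1 f) :=
    ev_map π (PrincipalChart.le_opens h)
  constructor
  · intro hab
    obtain ⟨f, hf⟩ := id h
    have hloc : IsPrincipalLoc f φ := PrincipalChart.isPrincipalLoc (PrincipalChart.le_opens h) hf
    rw [hev, hev] at hab
    obtain ⟨⟨_, n, rfl⟩, hn⟩ := hloc.exists_of_eq hab
    refine ⟨ScalarExt.x (f ^ n), ?_, ?_⟩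
    · rw [ScalarExt.map_x]
      exact (hloc.map_units ⟨_, n, rfl⟩).map ScalarExt.x
    · rw [map_mul, map_mul, ev_x]; exact hn
  · rintro ⟨s, hs, hab⟩
    have hs' := hs.map (ev π V.1)
    have h2 := congrArg φ hab
    rw [← hev, ← hev, map_mul (ScalarExt.map φ), map_mul (ScalarExt.map φ), map_mul (ev π V.1),
      map_mul (ev π V.1)] at h2
    exact hs'.mul_left_cancel h2

/-- The universal embedding of `X` into `X̂ = M(X) ×_{𝔽₁} k`, as a closed subscheme of `X̂`: on
every patch it is given by the kernel of the evaluation map. -/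
noncomputable def universalEmbedding :
    ((X.scalarRestriction 𝒰).baseChange k).ClosedSubscheme where
  con V := (⊥ : RingCon Γ(X, V.1)).comap (ev π V.1)
  quasiCoherent h a b := ev_localize 𝒰 π h a b

/-- The universal tropicalization of an integral scheme `X` over `k`: the tropicalization with
respect to the universal embedding, as a scheme over the tropical semiring. -/
noncomputable abbrev universalTropicalization [IsIntegral X] (ν : SemiringValuation k TropicalReal) :
    SemiringScheme.{u, u, 0} TropicalReal :=
  ((X.scalarRestriction 𝒰).tropicalization ν (universalEmbedding 𝒰 π)).toScheme

/-- A point of the Berkovich analytification of a `k`-scheme `X`: a point of `X` together with a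
non-archimedean absolute value on its residue field that extends the absolute value `exp ∘ ν`
of `k`. -/
structure BerkovichPoint (ν : SemiringValuation k TropicalReal) where
  pt : X
  abv : AbsoluteValue (X.residueField pt) ℝ
  nonarchimedean : IsNonarchimedean abv
  extends_abs : ∀ c : k, abv (X.evaluation ⊤ pt trivial (scalars π ⊤ c)) = (ν.toFun c).exp

/-- The Berkovich topology: the coarsest one for which the map to `X` is continuous and
for which `|f|` is continuous for every function `f` on an open subset of `X`. -/
instance (ν : SemiringValuation k TropicalReal) : TopologicalSpace (BerkovichPoint π ν) :=
  TopologicalSpace.generateFrom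
    ({O | ∃ U : X.Opens, O = {z | z.pt ∈ U}} ∪
      {O | ∃ (U : X.Opens) (f : Γ(X, U)) (D : Set ℝ), IsOpen D ∧
        O = {z | ∃ hz : z.pt ∈ U, z.abv (X.evaluation U z.pt hz f) ∈ D}})

end AlgebraicGeometry.Scheme

/-! A tropical point `q` of the patch of a ring `A` satisfies the bend relations of the kernel of
the evaluation map if and only if `a ↦ q (x a)` is a valuation of `A` that extends `ν`: the elements
`x (a + b) - x a - x b` and `x c - c • x 1` of the kernel give the ultrametric inequality and the
compatibility with `ν`, and these imply all other bend relations. Composition with `exp` turns such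
a valuation into a point of the analytification over `Spec A`: its kernel is a prime ideal and it
extends to the residue field. Both topologies are the topology of pointwise convergence on `A`. On
the analytification, this holds because every function on an open subset is locally a fraction of
elements of `A`. On the tropical side, the loci `{φ a ≠ φ b}` form a basis, since two of them
intersect in a third one. -/

namespace TropicalReal

theorem exp_zero : exp 0 = 0 := rfl

theorem exp_one : exp 1 = 1 := Real.exp_zero

theorem exp_mul (a b : TropicalReal) : exp (a * b) = exp a * exp b := by
  induction a using WithBot.recBotCoe with
  | bot => exact (congrArg exp (zero_mul b)).trans (zero_mul (exp b)).symm
  | coe a =>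
    induction b using WithBot.recBotCoe with
    | bot => exact (congrArg exp (mul_zero _)).trans (mul_zero (Real.exp a)).symm
    | coe b => exact Real.exp_add a b

/-- `exp` as a homomorphism of monoids with zero. -/
noncomputable def expHom : TropicalReal →*₀ ℝ where
  toFun := exp
  map_zero' := exp_zero
  map_one' := exp_one
  map_mul' := exp_mul

theorem exp_nonneg (a : TropicalReal) : 0 ≤ exp a := by
  induction a using WithBot.recBotCoe with
  | bot => exact le_rfl
  | coe a => exact (Real.exp_pos a).le

theorem exp_strictMono : StrictMono exp := by
  intro a b h
  induction b using WithBot.recBotCoe with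
  | bot => exact (not_lt_bot (α := WithBot ℝ) h).elim
  | coe b =>
    induction a using WithBot.recBotCoe with
    | bot => exact Real.exp_pos b
    | coe a => exact Real.exp_lt_exp.2 (WithBot.coe_lt_coe.1 h)

theorem exp_injective : Function.Injective exp := exp_strictMono.injective

theorem exp_add (a b : TropicalReal) : exp (a + b) = max (exp a) (exp b) :=
  exp_strictMono.monotone.map_max

theorem exp_eq_zero {a : TropicalReal} : exp a = 0 ↔ a = 0 :=
  exp_injective.eq_iff' exp_zero

theorem range_exp : Set.range exp = Set.Ici 0 := by
  refine (Set.range_subset_iff.2 exp_nonneg).antisymm fun r hr => ?_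
  rcases (Set.mem_Ici.1 hr).eq_or_lt with rfl | hr
  · exact ⟨0, exp_zero⟩
  · exact ⟨(Real.log r : WithBot ℝ), Real.exp_log hr⟩

theorem exists_monoidWithZeroHom_exp_eq {M : Type*} [MulZeroOneClass M] (N : M →*₀ ℝ)
    (hN : ∀ a, 0 ≤ N a) : ∃ w : M →*₀ TropicalReal, ∀ a, exp (w a) = N a := by
  have hrange (a : M) : N a ∈ Set.range exp := range_exp ▸ hN a
  choose w hw using hrange
  exact ⟨{  toFun := w
            map_zero' := exp_injective (by rw [hw, map_zero, exp_zero])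
            map_one' := exp_injective (by rw [hw, map_one, exp_one])
            map_mul' := fun a b => exp_injective (by rw [exp_mul, hw, hw, hw, map_mul]) }, hw⟩

noncomputable instance : OrderBot TropicalReal where
  bot := 0
  bot_le _ := bot_le (α := WithBot ℝ)

noncomputable instance : LinearOrderedCommGroupWithZero TropicalReal where
  inv a := WithBot.map Neg.neg a
  inv_zero := rfl
  exists_pair_ne := exists_pair_ne _
  mul_inv_cancel _ ha := by
    obtain ⟨r, rfl⟩ := WithBot.ne_bot_iff_exists.1 ha
    exact congrArg WithBot.some (add_neg_cancel r)
  isBot_zero _ := bot_le (α := WithBot ℝ)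
  mul_lt_mul_of_pos_left _ ha _ _ hbc := by
    refine exp_strictMono.lt_iff_lt.1 ?_
    simp only [exp_mul]
    exact mul_lt_mul_of_pos_left (exp_strictMono hbc) (exp_zero ▸ exp_strictMono ha)

instance : CanonicallyOrderedAdd TropicalReal where
  exists_add_of_le {_ b} h := ⟨b, (max_eq_right h).symm⟩
  le_add_self _ _ := le_max_right _ _
  le_self_add _ _ := le_max_left _ _

theorem mul_add_mul_lt {a b c d : TropicalReal} (hab : a < b) (hcd : c < d) :
    a * d + b * c < a * c + b * d :=
  calc a * d + b * c < b * d :=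
        max_lt (mul_lt_mul_of_pos_right hab (bot_le.trans_lt hcd))
          (mul_lt_mul_of_pos_left hcd (bot_le.trans_lt hab))
    _ ≤ a * c + b * d := le_add_self

theorem mul_add_mul_ne_iff {a b c d : TropicalReal} :
    a * c + b * d ≠ a * d + b * c ↔ a ≠ b ∧ c ≠ d := by
  refine ⟨fun h => ⟨?_, ?_⟩, ?_⟩
  · rintro rfl
    exact h (add_comm _ _)
  · rintro rfl
    exact h rfl
  · rintro ⟨hab, hcd⟩
    wlog hlt : a < b generalizing a b
    · rw [add_comm (a * c), add_comm (a * d)]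
      exact (this hab.symm (hab.lt_or_gt.resolve_left hlt)).symm
    wlog hlt' : c < d generalizing c d
    · exact (this hcd.symm (hcd.lt_or_gt.resolve_left hlt')).symm
    exact (mul_add_mul_lt hlt hlt').ne'

section topology

noncomputable instance : TopologicalSpace TropicalReal := Preorder.topology _

instance : OrderTopology TropicalReal := ⟨rfl⟩

theorem isEmbedding_exp : Topology.IsEmbedding exp :=
  exp_strictMono.isEmbedding_of_ordConnected (range_exp ▸ Set.ordConnected_Ici)

instance : ContinuousAdd TropicalReal := ⟨continuous_max⟩

instance : ContinuousMul TropicalReal := isEmbedding_exp.isInducing.continuousMul expHom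

variable {D : Type*} [CommSemiring D] [Algebra TropicalReal D]

/-- The topology of pointwise convergence on the tropical points of the spectrum of `D`. -/
noncomputable instance algHomTopology : TopologicalSpace (D →ₐ[TropicalReal] TropicalReal) :=
  .induced (fun φ a => φ a) inferInstance

theorem continuous_apply (a : D) :
    Continuous fun φ : D →ₐ[TropicalReal] TropicalReal => φ a :=
  (_root_.continuous_apply a).comp continuous_induced_dom

theorem continuous_algHom_iff {Z : Type*} [TopologicalSpace Z]
    {g : Z → D →ₐ[TropicalReal] TropicalReal} :
    Continuous g ↔ ∀ a, Continuous fun z => g z a :=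
  continuous_induced_rng.trans continuous_pi_iff

-- `mul_add_mul_ne_iff` makes the sets `{φ a ≠ φ b}` stable under finite intersections.
theorem isTopologicalBasis_ne : TopologicalSpace.IsTopologicalBasis
    {O : Set (D →ₐ[TropicalReal] TropicalReal) | ∃ a b, O = {φ | φ a ≠ φ b}} := by
  refine TopologicalSpace.isTopologicalBasis_of_subbasis_of_finiteInter
    (le_antisymm (le_generateFrom ?_) ?_) ⟨⟨1, 0, ?_⟩, ?_⟩
  · rintro _ ⟨a, b, rfl⟩
    exact isOpen_ne_fun (continuous_apply a) (continuous_apply b)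
  · refine continuous_iff_le_induced.1 (@continuous_pi _ _ _ (_) _ _ fun a => ?_)
    refine (@OrderTopology.continuous_iff _ _ _ _ _ (_) _).2 fun t =>
      ⟨.basic _ ⟨a + algebraMap _ _ t, algebraMap _ _ t, ?_⟩,
        .basic _ ⟨a + algebraMap _ _ t, a, ?_⟩⟩
    all_goals ext φ; simp [add_def]
  · simp
  · rintro _ ⟨a, b, rfl⟩ _ ⟨c, d, rfl⟩
    refine ⟨a * c + b * d, a * d + b * c, ?_⟩
    ext φ
    simp only [map_add, map_mul, mul_add_mul_ne_iff]
    rfl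

end topology

end TropicalReal

theorem SemiringValuation.map_add_le {R S : Type*} [CommRing R] [CommSemiring S] [PartialOrder S]
    [CanonicallyOrderedAdd S] (ν : SemiringValuation R S) (a b : R) :
    ν.toFun (a + b) ≤ ν.toFun a + ν.toFun b :=
  calc ν.toFun (a + b) ≤ ν.toFun (a + b) + (ν.toFun a + ν.toFun b) := le_self_add
    _ = ν.toFun a + ν.toFun b := by rw [← add_assoc, ν.subadditive]

namespace F1Scheme.MaxAttainedTwice

theorem apply_le_of_forall_ne {ι : Type*} {t : ι → TropicalReal} (ht : MaxAttainedTwice t) {b : ι}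
    {M : TropicalReal} (hM : ∀ c ≠ b, t c ≤ M) : t b ≤ M := by
  rcases ht with ht | ⟨c, c', hne, heq, hmax⟩
  · exact ht b ▸ bot_le
  · by_cases hc : c = b
    · exact hc ▸ heq ▸ hM c' (hc ▸ hne.symm)
    · exact (hmax b).trans (hM c hc)

end F1Scheme.MaxAttainedTwice

namespace ScalarExt

open F1Scheme

section coefficients

variable {S : Type*} [CommSemiring S] {B : Type*} [CommMonoidWithZero B]

theorem coeff_smul_x (s : S) {b : B} (hb : b ≠ 0) :
    (s • x b : ScalarExt S B).coeff = Finsupp.single b s := by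
  ext c
  simp [coeff_smul, x, proj, Finsupp.erase_single_ne hb.symm]

theorem erase_add_coeff_smul_x (b : B) (f : ScalarExt S B) :
    erase b f + f.coeff b • x b = f := by
  by_cases hb : b = 0
  · subst hb
    ext c
    by_cases hc : c = 0 <;> simp [erase, hc, f.coeff_zero]
  · ext1
    rw [coeff_add, coeff_smul_x _ hb]
    exact f.coeff.erase_add_single b

theorem sum_coeff_smul_x (f : ScalarExt S B) :
    ∑ b ∈ f.coeff.support, f.coeff b • x b = f := by
  let coeffHom : ScalarExt S B →+ (B →₀ S) := ⟨⟨coeff, zero_coeff⟩, coeff_add⟩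
  have hterm (b : B) (hb : b ∈ f.coeff.support) :
      coeffHom (f.coeff b • x b) = Finsupp.single b (f.coeff b) :=
    coeff_smul_x _ fun h => Finsupp.mem_support_iff.1 hb (h ▸ f.coeff_zero)
  ext1
  change coeffHom _ = _
  rw [map_sum, Finset.sum_congr rfl hterm]
  exact f.coeff.sum_single

theorem mapCoeff_erase {R : Type*} [CommSemiring R] (ν : R → S) (h0 : ν 0 = 0) (b : B)
    (f : ScalarExt R B) : mapCoeff ν h0 (erase b f) = erase b (mapCoeff ν h0 f) := by
  ext c
  by_cases hc : c = b <;> simp [mapCoeff, erase, hc, h0]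

/-- `erase b` as a linear map. -/
noncomputable def eraseLinear (b : B) : ScalarExt S B →ₗ[S] ScalarExt S B where
  toFun := erase b
  map_add' f g := ScalarExt.ext (Finsupp.erase_add b f.coeff g.coeff)
  map_smul' s f := by
    ext c
    by_cases hc : c = b <;> simp [erase, coeff_smul, hc]

theorem forall_bend_span_imp_iff {T : Type*} [CommSemiring T] [Algebra S T]
    (q : ScalarExt S B →ₐ[S] T) (s : Set (ScalarExt S B)) :
    (∀ f g, bend (Submodule.span S s) f g → q f = q g) ↔ ∀ f ∈ s, ∀ b, q f = q (erase b f) := by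
  constructor
  · intro h f hf b
    exact h _ _ (RingConGen.Rel.of _ _ ⟨f, Submodule.subset_span hf, b, rfl, rfl⟩)
  · intro h
    have hspan (b : B) :
        Submodule.span S s ≤ LinearMap.eqLocus q.toLinearMap (q.toLinearMap ∘ₗ eraseLinear b) :=
      Submodule.span_le.2 fun f hf => h f hf b
    have hle : bend (Submodule.span S s) ≤ (⊥ : RingCon T).comap q :=
      RingCon.ringConGen_le.2 fun _ _ ⟨_, hf, b, hp, hq⟩ => hp ▸ hq ▸ hspan b hf
    exact fun f g hfg => hle hfg

end coefficients

section tropical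

variable {B : Type*} [CommMonoidWithZero B]
  (q : ScalarExt TropicalReal B →ₐ[TropicalReal] TropicalReal)

theorem apply_coeff_smul_x_le (f : ScalarExt TropicalReal B) (b : B) :
    q (f.coeff b • x b) ≤ q f := by
  conv_rhs => rw [← erase_add_coeff_smul_x b f, map_add]
  exact le_add_self

theorem apply_le_iff {f : ScalarExt TropicalReal B} {M : TropicalReal} :
    q f ≤ M ↔ ∀ b, q (f.coeff b • x b) ≤ M := by
  refine ⟨fun h b => (apply_coeff_smul_x_le q f b).trans h, fun h => ?_⟩
  rw [← sum_coeff_smul_x f, map_sum]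
  exact Finset.sum_induction _ (· ≤ M) (fun _ _ => max_le) bot_le fun b _ => h b

theorem apply_erase_le_iff {f : ScalarExt TropicalReal B} {b : B} {M : TropicalReal} :
    q (erase b f) ≤ M ↔ ∀ c ≠ b, q (f.coeff c • x c) ≤ M := by
  rw [apply_le_iff]
  refine forall_congr' fun c => ?_
  by_cases hc : c = b
  · simp [erase, hc]
  · simp [erase, hc]

theorem exists_apply_coeff_smul_x_eq (f : ScalarExt TropicalReal B) :
    ∃ b, q (f.coeff b • x b) = q f := by
  classical
  obtain ⟨b, -, hb⟩ := (insert 0 f.coeff.support).exists_max_image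
    (fun c => q (f.coeff c • x c)) (Finset.insert_nonempty _ _)
  refine ⟨b, (apply_coeff_smul_x_le q f b).antisymm ((apply_le_iff q).2 fun c => ?_)⟩
  by_cases hc : c ∈ f.coeff.support
  · exact hb c (Finset.mem_insert_of_mem hc)
  · rw [Finsupp.notMem_support_iff.1 hc, zero_smul, map_zero]
    exact bot_le

theorem forall_apply_eq_erase_iff (f : ScalarExt TropicalReal B) :
    (∀ b, q f = q (erase b f)) ↔ MaxAttainedTwice fun b => q (f.coeff b • x b) := by
  constructor
  · intro h
    obtain ⟨b, hb⟩ := exists_apply_coeff_smul_x_eq q f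
    obtain ⟨c, hc⟩ := exists_apply_coeff_smul_x_eq q (erase b f)
    rw [← h] at hc
    by_cases hcb : c = b
    · have hf : q f = 0 := by rw [← hc, hcb]; simp [erase]
      exact .inl fun d => le_bot_iff.1 ((apply_coeff_smul_x_le q f d).trans hf.le)
    · simp only [erase, Finsupp.erase_ne hcb] at hc
      exact .inr ⟨b, c, Ne.symm hcb, hb.trans hc.symm,
        fun d => (apply_coeff_smul_x_le q f d).trans hb.ge⟩
  · intro h b
    have herase := (apply_erase_le_iff q).1 (le_refl (q (erase b f)))
    refine le_antisymm ((apply_le_iff q).2 fun c => ?_)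
      ((apply_erase_le_iff q).2 fun c _ => apply_coeff_smul_x_le q f c)
    obtain rfl | hcb := eq_or_ne c b
    · exact h.apply_le_of_forall_ne herase
    · exact herase c hcb

theorem forall_bend_trop_imp_iff {R : Type*} [CommRing R] (ν : SemiringValuation R TropicalReal)
    (I : Set (ScalarExt R B)) :
    (∀ f g, bend (trop ν I) f g → q f = q g) ↔
      ∀ f ∈ I, MaxAttainedTwice fun b => q (ν.toFun (f.coeff b) • x b) := by
  rw [trop, forall_bend_span_imp_iff, Set.forall_mem_image]
  exact forall₂_congr fun f _ => forall_apply_eq_erase_iff q _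

end tropical

section valuation

variable {R : Type*} [CommRing R] {B : Type*} [CommMonoidWithZero B]
  (ν : SemiringValuation R TropicalReal)
  (q : ScalarExt TropicalReal B →ₐ[TropicalReal] TropicalReal)

theorem mapCoeff_smul_x (c : R) (b : B) :
    mapCoeff ν.toFun ν.map_zero (c • x b) = ν.toFun c • x b := by
  by_cases hb : b = 0
  · ext d
    simp [hb, mapCoeff, zero_coeff]
  · ext d
    simp [mapCoeff, coeff_smul_x _ hb]

theorem apply_map_add_smul_le (c d : R) (f : ScalarExt TropicalReal B) :
    q (ν.toFun (c + d) • f) ≤ q (ν.toFun c • f) + q (ν.toFun d • f) := by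
  rw [← map_add, ← add_smul, map_smul, map_smul]
  exact mul_le_mul_left (ν.map_add_le c d) (q f)

theorem apply_mapCoeff_add_le (f g : ScalarExt R B) :
    q (mapCoeff ν.toFun ν.map_zero (f + g)) ≤
      q (mapCoeff ν.toFun ν.map_zero f) + q (mapCoeff ν.toFun ν.map_zero g) :=
  (apply_le_iff q).2 fun b => (apply_map_add_smul_le ν q (f.coeff b) (g.coeff b) (x b)).trans <|
    add_le_add (apply_coeff_smul_x_le q (mapCoeff ν.toFun ν.map_zero f) b)
      (apply_coeff_smul_x_le q (mapCoeff ν.toFun ν.map_zero g) b)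

end valuation

section evaluation

variable {k : Type*} [CommRing k] {A : Type*} [CommRing A] [Algebra k A]

variable (k A) in
/-- The evaluation map `∑ λ_a x_a ↦ ∑ λ_a a` of a `k`-algebra `A`. -/
noncomputable def evalHom : ScalarExt k A →ₐ[k] A := lift (MonoidWithZeroHom.id A)

theorem evalHom_x (a : A) : evalHom k A (x a) = a := lift_x _ _

theorem evalHom_smul_x (c : k) (a : A) : evalHom k A (c • x a) = algebraMap k A c * a := by
  rw [map_smul, evalHom_x, Algebra.smul_def]

variable (ν : SemiringValuation k TropicalReal)
  (q : ScalarExt TropicalReal A →ₐ[TropicalReal] TropicalReal)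

-- The tropical condition is applied to `x b - g` for `b = evalHom k A g`, at the monomial of `b`.
theorem apply_x_evalHom_le_of_maxAttainedTwice
    (h : ∀ f, evalHom k A f = 0 → MaxAttainedTwice fun b => q (ν.toFun (f.coeff b) • x b))
    (g : ScalarExt k A) : q (x (evalHom k A g)) ≤ q (mapCoeff ν.toFun ν.map_zero g) := by
  set b := evalHom k A g with hb
  by_cases hb0 : b = 0
  · rw [hb0, map_zero, map_zero]
    exact bot_le
  have hcoeff : ((1 : k) • x b + (-1 : k) • g).coeff = .single b 1 - g.coeff := by
    rw [coeff_add, coeff_smul_x _ hb0, coeff_smul, neg_one_smul, sub_eq_add_neg]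
  have hmax := h ((1 : k) • x b + (-1 : k) • g) (by simp [evalHom_x, ← hb])
  have hsub : q (ν.toFun (1 - g.coeff b) • x b) ≤ q (mapCoeff ν.toFun ν.map_zero g) := by
    rw [hcoeff] at hmax
    have hle : q (ν.toFun ((Finsupp.single b (1 : k) - g.coeff) b) • x b) ≤
        q (mapCoeff ν.toFun ν.map_zero g) := by
      refine hmax.apply_le_of_forall_ne fun c hc => ?_
      rw [Finsupp.sub_apply, Finsupp.single_eq_of_ne hc, zero_sub, ν.map_neg]
      exact apply_coeff_smul_x_le q (mapCoeff ν.toFun ν.map_zero g) c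
    rwa [Finsupp.sub_apply, Finsupp.single_eq_same] at hle
  calc q (x b) = q (ν.toFun (1 - g.coeff b + g.coeff b) • x b) := by
        rw [sub_add_cancel, ν.map_one, one_smul]
    _ ≤ q (ν.toFun (1 - g.coeff b) • x b) + q (ν.toFun (g.coeff b) • x b) :=
        apply_map_add_smul_le ν q _ _ _
    _ ≤ q (mapCoeff ν.toFun ν.map_zero g) :=
        max_le hsub (apply_coeff_smul_x_le q (mapCoeff ν.toFun ν.map_zero g) b)

theorem apply_x_add_le (h : ∀ g, q (x (evalHom k A g)) ≤ q (mapCoeff ν.toFun ν.map_zero g))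
    (a b : A) : q (x (a + b)) ≤ q (x a) + q (x b) := by
  have hle := (h ((1 : k) • x a + (1 : k) • x b)).trans (apply_mapCoeff_add_le ν q _ _)
  rwa [map_add, evalHom_smul_x, evalHom_smul_x, map_one, one_mul, one_mul, mapCoeff_smul_x,
    mapCoeff_smul_x, ν.map_one, one_smul, one_smul] at hle

theorem apply_x_algebraMap_le
    (h : ∀ g, q (x (evalHom k A g)) ≤ q (mapCoeff ν.toFun ν.map_zero g)) (c : k) :
    q (x (algebraMap k A c)) ≤ ν.toFun c := by
  have hle := h (c • x 1)
  rwa [mapCoeff_smul_x, evalHom_smul_x, mul_one, map_smul, map_one, map_one, smul_eq_mul,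
    mul_one] at hle

theorem apply_x_evalHom_le (hadd : ∀ a b, q (x (a + b)) ≤ q (x a) + q (x b))
    (hscalar : ∀ c, q (x (algebraMap k A c)) = ν.toFun c) (g : ScalarExt k A) :
    q (x (evalHom k A g)) ≤ q (mapCoeff ν.toFun ν.map_zero g) := by
  have hterm (b : A) : q (x (evalHom k A (g.coeff b • x b))) ≤
      q (mapCoeff ν.toFun ν.map_zero g) := by
    have hle := apply_coeff_smul_x_le q (mapCoeff ν.toFun ν.map_zero g) b
    rw [map_smul] at hle
    rw [evalHom_smul_x, map_mul, map_mul, hscalar]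
    exact hle
  conv_lhs => rw [← sum_coeff_smul_x g, map_sum]
  refine Finset.sum_induction _ (fun a => q (x a) ≤ q (mapCoeff ν.toFun ν.map_zero g))
    (fun a b ha hb => (hadd a b).trans (max_le ha hb)) ?_ fun b _ => hterm b
  rw [map_zero, map_zero]
  exact bot_le

end evaluation

section field

variable {k : Type*} [Field k] {A : Type*} [CommRing A] [Algebra k A]
  (ν : SemiringValuation k TropicalReal)
  (q : ScalarExt TropicalReal A →ₐ[TropicalReal] TropicalReal)

theorem apply_x_algebraMap
    (h : ∀ g, q (x (evalHom k A g)) ≤ q (mapCoeff ν.toFun ν.map_zero g)) (c : k) :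
    q (x (algebraMap k A c)) = ν.toFun c := by
  refine (apply_x_algebraMap_le ν q h c).antisymm ?_
  by_cases hc : c = 0
  · rw [hc, ν.map_zero]
    exact bot_le
  calc ν.toFun c = ν.toFun c * (q (x (algebraMap k A c⁻¹)) * q (x (algebraMap k A c))) := by
        rw [← map_mul, ← map_mul, ← map_mul, inv_mul_cancel₀ hc, map_one, map_one, map_one,
          mul_one]
    _ ≤ ν.toFun c * (ν.toFun c⁻¹ * q (x (algebraMap k A c))) := by
        gcongr
        exact apply_x_algebraMap_le ν q h _
    _ = q (x (algebraMap k A c)) := by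
        rw [← mul_assoc, ← ν.map_mul, mul_inv_cancel₀ hc, ν.map_one, one_mul]

theorem forall_maxAttainedTwice_iff :
    (∀ f, evalHom k A f = 0 → MaxAttainedTwice fun b => q (ν.toFun (f.coeff b) • x b)) ↔
      (∀ a b, q (x (a + b)) ≤ q (x a) + q (x b)) ∧
        ∀ c, q (x (algebraMap k A c)) = ν.toFun c := by
  constructor
  · intro h
    have hle := apply_x_evalHom_le_of_maxAttainedTwice ν q h
    exact ⟨apply_x_add_le ν q hle, apply_x_algebraMap ν q hle⟩
  · rintro ⟨hadd, hscalar⟩ f hf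
    refine (forall_apply_eq_erase_iff q (mapCoeff ν.toFun ν.map_zero f)).1 fun b => ?_
    refine le_antisymm ?_ ((apply_erase_le_iff q).2 fun c _ => apply_coeff_smul_x_le q _ c)
    have heval : evalHom k A (erase b f) = algebraMap k A (-f.coeff b) * b := by
      rw [map_neg, neg_mul, ← evalHom_smul_x, eq_neg_iff_add_eq_zero, ← map_add,
        erase_add_coeff_smul_x, hf]
    have hterm : q (ν.toFun (f.coeff b) • x b) ≤ q (erase b (mapCoeff ν.toFun ν.map_zero f)) :=
      calc q (ν.toFun (f.coeff b) • x b) = q (x (evalHom k A (erase b f))) := by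
            rw [heval, map_mul, map_mul, hscalar, ν.map_neg, map_smul, smul_eq_mul]
        _ ≤ q (mapCoeff ν.toFun ν.map_zero (erase b f)) := apply_x_evalHom_le ν q hadd hscalar _
        _ = q (erase b (mapCoeff ν.toFun ν.map_zero f)) := by rw [mapCoeff_erase]
    conv_lhs => rw [← erase_add_coeff_smul_x b (mapCoeff ν.toFun ν.map_zero f), map_add]
    exact max_le le_rfl hterm

end field

theorem continuous_algHom_iff_of_surjective {B D : Type*} [CommMonoidWithZero B]
    [CommSemiring D] [Algebra TropicalReal D] {ϖ : ScalarExt TropicalReal B →ₐ[TropicalReal] D}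
    (hϖ : Function.Surjective ϖ) {Z : Type*} [TopologicalSpace Z]
    {g : Z → D →ₐ[TropicalReal] TropicalReal} :
    Continuous g ↔ ∀ b, Continuous fun t => g t (ϖ (x b)) := by
  rw [TropicalReal.continuous_algHom_iff]
  refine ⟨fun hg b => hg _, fun hg => hϖ.forall.2 fun f => ?_⟩
  rw [← sum_coeff_smul_x f]
  simp only [map_sum, map_smul]
  exact continuous_finsetSum _ fun b _ => continuous_const.mul (hg b)

end ScalarExt

namespace SemiringScheme

section points

variable {S : Type w} [CommSemiring S] {Y : SemiringScheme.{u, v, w} S}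
  {T : Type*} [CommSemiring T] [Algebra S T]

theorem exists_comp_res_eq {i j : Y.Chart} (h : i ≤ j) {f : Y.alg j}
    (hf : IsPrincipalLoc f (Y.res h)) (φ : Y.alg j →ₐ[S] T) (hφ : IsUnit (φ f)) :
    ∃ χ : Y.alg i →ₐ[S] T, χ.comp (Y.res h) = φ := by
  let := (Y.res h : Y.alg j →+* Y.alg i).toAlgebra
  have : IsLocalization (Submonoid.powers f) (Y.alg i) :=
    (isLocalization_iff_isLocalizationMap _ _).2 hf
  have hunits (s : Submonoid.powers f) : IsUnit ((φ : Y.alg j →+* T) s) := by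
    obtain ⟨_, n, rfl⟩ := s
    exact (map_pow φ f n).symm ▸ hφ.pow n
  have hlift (a : Y.alg j) : IsLocalization.lift (S := Y.alg i) hunits (Y.res h a) = φ a :=
    IsLocalization.lift_eq hunits a
  refine ⟨{ IsLocalization.lift (S := Y.alg i) hunits with commutes' := fun s => ?_ },
    AlgHom.ext hlift⟩
  change IsLocalization.lift (S := Y.alg i) hunits _ = _
  rw [← (Y.res h).commutes s, hlift, φ.commutes]

theorem exists_isUnit_mul_eq_res {i j : Y.Chart} (h : i ≤ j) (a : Y.alg i) :
    ∃ s b, IsUnit (Y.res h s) ∧ Y.res h s * a = Y.res h b := by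
  obtain ⟨f, hf⟩ := Y.exists_principalLoc h
  obtain ⟨⟨b, s⟩, hs⟩ := hf.surj a
  exact ⟨s, b, hf.map_units s, (mul_comm _ _).trans hs⟩

theorem exists_isUnit_mul_eq_res₂ {i j : Y.Chart} (h : i ≤ j) (a b : Y.alg i) :
    ∃ s a' b', IsUnit (Y.res h s) ∧ Y.res h s * a = Y.res h a' ∧ Y.res h s * b = Y.res h b' := by
  obtain ⟨s, a', hs, ha⟩ := exists_isUnit_mul_eq_res h a
  obtain ⟨t, b', ht, hb⟩ := exists_isUnit_mul_eq_res h b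
  refine ⟨s * t, t * a', s * b', map_mul (Y.res h) s t ▸ hs.mul ht, ?_, ?_⟩
  · rw [map_mul, map_mul, ← ha, mul_left_comm, mul_assoc]
  · rw [map_mul, map_mul, ← hb, mul_assoc]

theorem comp_res_injective {i j : Y.Chart} (h : i ≤ j) :
    Function.Injective fun χ : Y.alg i →ₐ[S] T => χ.comp (Y.res h) := by
  intro χ χ' hχ
  ext a
  obtain ⟨s, b, hs, hb⟩ := exists_isUnit_mul_eq_res h a
  have hres (b : Y.alg j) : χ (Y.res h b) = χ' (Y.res h b) := DFunLike.congr_fun hχ b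
  refine (hs.map χ).mul_left_cancel ?_
  rw [← map_mul, hb, hres, hres, ← hb, map_mul]

theorem comp_res_comp_res {i j l : Y.Chart} (h : i ≤ j) (h' : j ≤ l) (χ : Y.alg i →ₐ[S] T) :
    (χ.comp (Y.res h)).comp (Y.res h') = χ.comp (Y.res (h.trans h')) :=
  AlgHom.ext fun a => congrArg χ (Y.res_trans h h' a)

theorem comp_res_refl (i : Y.Chart) (χ : Y.alg i →ₐ[S] T) : χ.comp (Y.res le_rfl) = χ :=
  AlgHom.ext fun a => congrArg χ (Y.res_refl i a)

-- For transitivity, both points of the middle patch extend to a principal open subset on which the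
-- product of the two equations is inverted.
theorem pointRel_equivalence (T : Type*) [CommSemiring T] [Algebra S T] :
    Equivalence (Y.PointRel T) where
  refl p := ⟨p.1, le_rfl, le_rfl, p.2, comp_res_refl _ _, comp_res_refl _ _⟩
  symm := fun ⟨l, h, h', χ, hp, hq⟩ => ⟨l, h', h, χ, hq, hp⟩
  trans := by
    rintro p q r ⟨l, hlp, hlq, χ, hχp, hχq⟩ ⟨l', hlq', hlr', χ', hχq', hχr'⟩
    obtain ⟨b, b', m, hm, hm', hb, hb', hbb'⟩ := Y.inter hlq hlq'
    have hunit : IsUnit (q.2 b) := hχq ▸ (hb.map_units ⟨b, 1, pow_one b⟩).map χ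
    have hunit' : IsUnit (q.2 b') := hχq' ▸ (hb'.map_units ⟨b', 1, pow_one b'⟩).map χ'
    obtain ⟨θ, hθ⟩ := exists_comp_res_eq (hm.trans hlq) hbb' q.2
      (map_mul q.2 b b' ▸ hunit.mul hunit')
    have hθχ : θ.comp (Y.res hm) = χ :=
      comp_res_injective hlq ((comp_res_comp_res hm hlq θ).trans (hθ.trans hχq.symm))
    have hθχ' : θ.comp (Y.res hm') = χ' :=
      comp_res_injective hlq' ((comp_res_comp_res hm' hlq' θ).trans (hθ.trans hχq'.symm))
    refine ⟨m, hm.trans hlp, hm'.trans hlr', θ, ?_, ?_⟩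
    · rw [← comp_res_comp_res hm hlp, hθχ, hχp]
    · rw [← comp_res_comp_res hm' hlr', hθχ', hχr']

namespace ClosedSubscheme

variable (Z : Y.ClosedSubscheme)

theorem forall_con_imp_comp_res_iff {i j : Y.Chart} (h : i ≤ j) (χ : Y.alg i →ₐ[S] T) :
    (∀ a b, Z.con j a b → χ.comp (Y.res h) a = χ.comp (Y.res h) b) ↔
      ∀ a b, Z.con i a b → χ a = χ b := by
  refine ⟨fun H a b hab => ?_, fun H a b hab => H _ _ (Z.con_res h hab)⟩
  obtain ⟨s, a', b', hs, ha, hb⟩ := exists_isUnit_mul_eq_res₂ h a b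
  have hab' : Z.con i (Y.res h a') (Y.res h b') :=
    ha ▸ hb ▸ (Z.con i).mul ((Z.con i).refl (Y.res h s)) hab
  obtain ⟨t, ht, hcon⟩ := (Z.quasiCoherent h a' b').1 hab'
  have hχ := H _ _ hcon
  simp only [AlgHom.comp_apply, map_mul, ← ha, ← hb] at hχ
  exact (hs.map χ).mul_left_cancel ((ht.map χ).mul_left_cancel hχ)

/-- The `T`-point of a closed subscheme given by a `T`-point of the ambient patch that satisfies
the equations. -/
noncomputable def liftHom {i : Y.Chart} (φ : Y.alg i →ₐ[S] T)
    (h : ∀ a b, Z.con i a b → φ a = φ b) : (Z.con i).Quotient →ₐ[S] T where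
  toRingHom := (Z.con i).lift (φ : Y.alg i →+* T) h
  commutes' s := φ.commutes s

theorem quotMap_surjective (i : Y.Chart) : Function.Surjective (Z.quotMap i) :=
  (Z.con i).mk'_surjective

theorem comp_quotMap_eq_of_con {i : Y.Chart} (φ : (Z.con i).Quotient →ₐ[S] T) (a b : Y.alg i)
    (h : Z.con i a b) : φ.comp (Z.quotMap i) a = φ.comp (Z.quotMap i) b :=
  congrArg φ ((Z.con i).eq.2 h)

theorem comp_quotMap_injective (i : Y.Chart) :
    Function.Injective fun φ : (Z.con i).Quotient →ₐ[S] T => φ.comp (Z.quotMap i) :=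
  fun _ _ h => AlgHom.ext <| (Z.quotMap_surjective i).forall.2 (DFunLike.congr_fun h)

end ClosedSubscheme

variable [IsLocalRing T]

theorem point_eq_point_iff {i j : Y.Chart} {φ : Y.alg i →ₐ[S] T} {ψ : Y.alg j →ₐ[S] T} :
    Y.point i φ = Y.point j ψ ↔ Y.PointRel T ⟨i, φ⟩ ⟨j, ψ⟩ :=
  ⟨fun h => (pointRel_equivalence T).eqvGen_iff.1 (Quot.eqvGen_exact h), fun h => Quot.sound h⟩

theorem point_comp_res {i j : Y.Chart} (h : i ≤ j) (χ : Y.alg i →ₐ[S] T) :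
    Y.point j (χ.comp (Y.res h)) = Y.point i χ :=
  point_eq_point_iff.2 ⟨i, h, le_rfl, χ, rfl, comp_res_refl i χ⟩

theorem exists_point_eq (p : Y.Points T) : ∃ i φ, Y.point i φ = p :=
  Quot.inductionOn p fun p => ⟨p.1, p.2, rfl⟩

namespace ClosedSubscheme

variable (Z : Y.ClosedSubscheme)

theorem incl_point (i : Y.Chart) (φ : (Z.con i).Quotient →ₐ[S] T) :
    Z.incl T (Z.toScheme.point i φ) = Y.point i (φ.comp (Z.quotMap i)) := rfl

theorem incl_injective : Function.Injective (Z.incl T) := by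
  intro p q hpq
  obtain ⟨i, φ, rfl⟩ := exists_point_eq p
  obtain ⟨j, ψ, rfl⟩ := exists_point_eq q
  rw [incl_point, incl_point, point_eq_point_iff] at hpq
  obtain ⟨l, h, h', χ, hφ, hψ⟩ := hpq
  dsimp only at h h' hφ hψ
  have hχ := (Z.forall_con_imp_comp_res_iff h χ).1 (hφ ▸ Z.comp_quotMap_eq_of_con φ)
  exact point_eq_point_iff.2 ⟨l, h, h', Z.liftHom χ hχ, Z.comp_quotMap_injective i hφ,
    Z.comp_quotMap_injective j hψ⟩

theorem point_mem_points_iff {i : Y.Chart} {φ : Y.alg i →ₐ[S] T} :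
    Y.point i φ ∈ Z.points T ↔ ∀ a b, Z.con i a b → φ a = φ b := by
  constructor
  · rintro ⟨p, hp⟩
    obtain ⟨j, ψ, rfl⟩ := exists_point_eq p
    rw [incl_point, point_eq_point_iff] at hp
    obtain ⟨l, h, h', χ, hψ, hφ⟩ := hp
    dsimp only at h h' hφ hψ
    rw [← hφ, Z.forall_con_imp_comp_res_iff h', ← Z.forall_con_imp_comp_res_iff h, hψ]
    exact Z.comp_quotMap_eq_of_con ψ
  · intro h
    exact ⟨Z.toScheme.point i (Z.liftHom φ h), rfl⟩

end ClosedSubscheme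

/-- The closed subscheme cut out by all equations that hold at a set `C` of points with values in
a semiring in which all nonzero elements are units. -/
def vanishing (hT : ∀ t : T, t ≠ 0 → IsUnit t) (C : Set (Y.Points T)) : Y.ClosedSubscheme where
  con i :=
    { r a b := ∀ φ : Y.alg i →ₐ[S] T, Y.point i φ ∈ C → φ a = φ b
      iseqv := ⟨fun _ _ _ => rfl, fun h φ hφ => (h φ hφ).symm,
        fun h h' φ hφ => (h φ hφ).trans (h' φ hφ)⟩
      add' h h' φ hφ := by rw [map_add, map_add, h φ hφ, h' φ hφ]
      mul' h h' φ hφ := by rw [map_mul, map_mul, h φ hφ, h' φ hφ] }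
  quasiCoherent {i j} h a b := by
    constructor
    · intro hab
      obtain ⟨f, hf⟩ := Y.exists_principalLoc h
      refine ⟨f, hf.map_units ⟨f, 1, pow_one f⟩, fun φ hφ => ?_⟩
      rw [map_mul, map_mul]
      by_cases h0 : φ f = 0
      · rw [h0, zero_mul, zero_mul]
      · obtain ⟨χ, rfl⟩ := exists_comp_res_eq h hf φ (hT _ h0)
        exact congrArg (_ * ·) (hab χ (point_comp_res h χ ▸ hφ))
    · rintro ⟨s, hs, hab⟩ χ hχ
      have hmul := hab (χ.comp (Y.res h)) ((point_comp_res h χ).symm ▸ hχ)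
      rw [map_mul, map_mul] at hmul
      exact (hs.map χ).mul_left_cancel hmul

end points

section strongZariski

variable {Y : SemiringScheme.{u, v, 0} TropicalReal}

theorem ClosedSubscheme.isClosed_preimage_points (Z : Y.ClosedSubscheme) (i : Y.Chart) :
    IsClosed (Y.point i ⁻¹' Z.points TropicalReal) := by
  have hpre : Y.point i ⁻¹' Z.points TropicalReal =
      ⋂ (a) (b) (_ : Z.con i a b), {φ | φ a = φ b} := by
    ext φ
    simp only [Set.mem_preimage, Z.point_mem_points_iff, Set.mem_iInter, Set.mem_ofPred_eq]
  rw [hpre]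
  exact isClosed_iInter fun a => isClosed_iInter fun b => isClosed_iInter fun _ =>
    isClosed_eq (TropicalReal.continuous_apply a) (TropicalReal.continuous_apply b)

theorem continuous_point (i : Y.Chart) :
    Continuous (Y.point i : _ → Y.Points TropicalReal) := by
  refine continuous_generateFrom_iff.2 ?_
  rintro _ ⟨Z, rfl⟩
  exact (Z.isClosed_preimage_points i).isOpen_compl

theorem exists_eq_points_of_isClosed_preimage {C : Set (Y.Points TropicalReal)}
    (hC : ∀ i, IsClosed (Y.point i ⁻¹' C)) :
    ∃ Z : Y.ClosedSubscheme, C = Z.points TropicalReal := by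
  refine ⟨vanishing (fun _ => IsUnit.mk0 _) C, Set.ext fun p => ?_⟩
  obtain ⟨i, φ, rfl⟩ := exists_point_eq p
  rw [ClosedSubscheme.point_mem_points_iff]
  refine ⟨fun hφ a b hab => hab φ hφ, fun hφ => by_contra fun hn => ?_⟩
  obtain ⟨_, ⟨a, b, rfl⟩, hne, hsub⟩ :=
    TropicalReal.isTopologicalBasis_ne.mem_nhds_iff.1 ((hC i).isOpen_compl.mem_nhds hn)
  exact hne (hφ a b fun ψ hψ => by_contra fun hψ' => hsub hψ' hψ)

theorem isClosed_points (Z : Y.ClosedSubscheme) : IsClosed (Z.points TropicalReal) :=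
  ⟨.basic _ ⟨Z, rfl⟩⟩

theorem isClosed_iff_exists_eq_points {C : Set (Y.Points TropicalReal)} :
    IsClosed C ↔ ∃ Z : Y.ClosedSubscheme, C = Z.points TropicalReal :=
  ⟨fun hC => exists_eq_points_of_isClosed_preimage fun i => hC.preimage (continuous_point i),
    fun ⟨Z, hZ⟩ => hZ ▸ isClosed_points Z⟩

theorem isOpen_iff_forall_isOpen_preimage_point {O : Set (Y.Points TropicalReal)} :
    IsOpen O ↔ ∀ i, IsOpen (Y.point i ⁻¹' O) := by
  refine ⟨fun hO i => hO.preimage (continuous_point i), fun hO => ?_⟩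
  obtain ⟨Z, hZ⟩ := exists_eq_points_of_isClosed_preimage (C := Oᶜ) fun i => (hO i).isClosed_compl
  exact isClosed_compl_iff.1 (hZ ▸ isClosed_points Z)

end strongZariski

end SemiringScheme

theorem F1Scheme.range_incl_tropicalization {R : Type*} [CommRing R] (Y : F1Scheme.{u, v})
    [Y.IsLocallyIntegral] (ν : SemiringValuation R TropicalReal)
    (X : (Y.baseChange R).ClosedSubscheme) :
    Set.range ((Y.tropicalization ν X).incl TropicalReal) = Y.setTropicalization ν X := by
  have hmem (i : Y.Chart) (q : ScalarExt TropicalReal (Y.alg i) →ₐ[TropicalReal] TropicalReal) :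
      (Y.baseChange TropicalReal).point i q ∈ (Y.tropicalization ν X).points TropicalReal ↔
        ∀ f : ScalarExt R (Y.alg i), X.con i f 0 →
          MaxAttainedTwice fun b => q (ν.toFun (f.coeff b) • ScalarExt.x b) :=
    (Y.tropicalization ν X).point_mem_points_iff.trans (ScalarExt.forall_bend_trop_imp_iff q ν _)
  ext p
  constructor
  · intro hp
    obtain ⟨i, q, rfl⟩ := SemiringScheme.exists_point_eq p
    exact ⟨i, q, rfl, (hmem i q).1 hp⟩
  · rintro ⟨i, q, rfl, hq⟩
    exact (hmem i q).2 hq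

/-- The absolute value `exp ∘ v` attached to a tropical valuation `v` of a field. -/
noncomputable def TropicalReal.absoluteValue {K : Type*} [Field K] (v : Valuation K TropicalReal) :
    AbsoluteValue K ℝ where
  toFun a := exp (v a)
  map_mul' a b := by rw [map_mul, exp_mul]
  nonneg' a := exp_nonneg _
  eq_zero' _ := exp_eq_zero.trans v.zero_iff
  add_le' a b := (exp_strictMono.monotone (v.map_add a b)).trans <|
    (exp_add _ _).trans_le (max_le_add_of_nonneg (exp_nonneg _) (exp_nonneg _))

theorem TropicalReal.isNonarchimedean_absoluteValue {K : Type*} [Field K]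
    (v : Valuation K TropicalReal) : IsNonarchimedean (absoluteValue v) := fun a b =>
  (exp_strictMono.monotone (v.map_add a b)).trans_eq (exp_add _ _)

namespace UniversalTropicalization

open AlgebraicGeometry.Scheme

section valuation

variable {A K Γ₀ : Type*} [CommRing A] [Field K] [LinearOrderedCommGroupWithZero Γ₀]

theorem exists_valuation_comap_eq (v : Valuation A Γ₀) (ρ : A →+* K)
    (hker : RingHom.ker ρ = v.supp) (hρ : ∀ c, ∃ a b, ρ b ≠ 0 ∧ c * ρ b = ρ a) :
    ∃ w : Valuation K Γ₀, w.comap ρ = v := by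
  let Q := A ⧸ RingHom.ker ρ
  let : Algebra Q K := ρ.kerLift.toAlgebra
  have : FaithfulSMul Q K := (faithfulSMul_iff_algebraMap_injective Q K).2 ρ.kerLift_injective
  have : IsFractionRing Q K := .of_field Q K fun c => by
    obtain ⟨a, b, hb, hc⟩ := hρ c
    exact ⟨Ideal.Quotient.mk _ a, Ideal.Quotient.mk _ b, (eq_div_iff hb).2 hc⟩
  let vQ : Valuation Q Γ₀ := v.onQuot hker.le
  have hsupp : nonZeroDivisors Q ≤ vQ.supp.primeCompl := by
    have hbot : vQ.supp = ⊥ := by rw [v.supp_quot, ← hker, Ideal.map_quotient_self]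
    intro a ha h0
    have := (algebraMap Q K).domain_nontrivial
    exact nonZeroDivisors.ne_zero ha (hbot.le h0)
  exact ⟨vQ.extendToLocalization hsupp K, Valuation.ext fun a =>
    vQ.extendToLocalization_apply_map_apply hsupp K (Ideal.Quotient.mk _ a)⟩

end valuation

section evaluation

variable {X : Scheme.{u}}

theorem evaluation_res {U V : X.Opens} (h : V ≤ U) {y : X} (hy : y ∈ V) (f : Γ(X, U)) :
    X.evaluation V y hy (X.presheaf.map (homOfLE h).op f) = X.evaluation U y (h hy) f :=
  congrArg (fun θ => (θ ≫ X.residue y) f) (X.presheaf.germ_res (homOfLE h) y hy)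

theorem exists_evaluation_mul_pow_eq {U V : X.Opens} (hV : IsAffineOpen V) {y : X} (hyU : y ∈ U)
    (hyV : y ∈ V) (f : Γ(X, U)) :
    ∃ (g h : Γ(X, V)) (n : ℕ), y ∈ X.basicOpen g ∧ ∀ (y' : X) (hy'V : y' ∈ V),
      y' ∈ X.basicOpen g → ∃ hy' : y' ∈ U, X.evaluation U y' hy' f *
        X.evaluation V y' hy'V g ^ n = X.evaluation V y' hy'V h := by
  obtain ⟨g, hgU, hyg⟩ := hV.exists_basicOpen_le ⟨y, hyU⟩ hyV
  have := hV.isLocalization_basicOpen g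
  obtain ⟨⟨h, ⟨_, n, rfl⟩⟩, hh⟩ := IsLocalization.surj (Submonoid.powers g)
    (X.presheaf.map (homOfLE hgU).op f : Γ(X, X.basicOpen g))
  refine ⟨g, h, n, hyg, fun y' hy'V hy'g => ⟨hgU hy'g, ?_⟩⟩
  have heval := congrArg (X.evaluation _ y' hy'g) hh
  change X.evaluation _ y' hy'g (_ * X.presheaf.map (homOfLE (X.basicOpen_le g)).op (g ^ n)) =
    X.evaluation _ y' hy'g (X.presheaf.map (homOfLE (X.basicOpen_le g)).op h) at heval
  rwa [map_mul, evaluation_res, evaluation_res, evaluation_res, map_pow] at heval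

theorem exists_mul_evaluation_eq {V : X.Opens} (hV : IsAffineOpen V) {y : X} (hyV : y ∈ V)
    (c : X.residueField y) :
    ∃ a b : Γ(X, V), X.evaluation V y hyV b ≠ 0 ∧
      c * X.evaluation V y hyV b = X.evaluation V y hyV a := by
  obtain ⟨s, rfl⟩ := X.residue_surjective y c
  obtain ⟨U, hyU, f, rfl⟩ := X.presheaf.exists_germ_eq s
  obtain ⟨g, h, n, hg, H⟩ := exists_evaluation_mul_pow_eq hV hyU hyV f
  obtain ⟨_, heval⟩ := H y hyV hg
  refine ⟨h, g ^ n, ?_, ?_⟩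
  · rw [map_pow]
    exact pow_ne_zero n ((X.evaluation_ne_zero_iff_mem_basicOpen y hyV g).2 hg)
  · rw [map_pow]
    exact heval

theorem exists_evaluation_eq_zero_iff {V : X.Opens} (hV : IsAffineOpen V)
    (P : PrimeSpectrum Γ(X, V)) :
    ∃ (y : X) (hy : y ∈ V), ∀ f, X.evaluation V y hy f = 0 ↔ f ∈ P.asIdeal := by
  have hy : hV.fromSpec P ∈ V := hV.range_fromSpec.le ⟨P, rfl⟩
  refine ⟨hV.fromSpec P, hy, fun f => ?_⟩
  rw [evaluation_eq_zero_iff_notMem_basicOpen]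
  change P ∉ hV.fromSpec ⁻¹ᵁ X.basicOpen f ↔ _
  rw [hV.fromSpec_preimage_basicOpen]
  exact not_not

theorem mem_of_forall_evaluation_eq_zero_imp {V O : X.Opens} (hV : IsAffineOpen V) {y y' : X}
    (hy : y ∈ V) (hy' : y' ∈ V)
    (h : ∀ f, X.evaluation V y' hy' f = 0 → X.evaluation V y hy f = 0) (hyO : y ∈ O) : y' ∈ O := by
  obtain ⟨f, hf, hyf⟩ := hV.exists_basicOpen_le (V := O) ⟨y, hyO⟩ hy
  rw [← evaluation_ne_zero_iff_mem_basicOpen X y hy] at hyf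
  exact hf ((X.evaluation_ne_zero_iff_mem_basicOpen y' hy' f).1 (mt (h f) hyf))

theorem eq_of_evaluation_eq_zero_iff {V : X.Opens} (hV : IsAffineOpen V) {y y' : X} (hy : y ∈ V)
    (hy' : y' ∈ V) (h : ∀ f, X.evaluation V y hy f = 0 ↔ X.evaluation V y' hy' f = 0) : y = y' :=
  (inseparable_iff_forall_isOpen.2 fun O hO =>
    ⟨mem_of_forall_evaluation_eq_zero_imp (O := ⟨O, hO⟩) hV hy hy' fun f => (h f).2,
      mem_of_forall_evaluation_eq_zero_imp (O := ⟨O, hO⟩) hV hy' hy fun f => (h f).1⟩).eq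

end evaluation

section charts

variable {X : Scheme.{u}} {𝒰 : Set X.affineOpens}

theorem exists_principalChart_le_le (V W : X.PrincipalChart 𝒰) {y : X} (hV : y ∈ V.1)
    (hW : y ∈ W.1) : ∃ L : X.PrincipalChart 𝒰, L ≤ V ∧ L ≤ W ∧ y ∈ L.1 := by
  obtain ⟨f, g, hfg, hy⟩ := exists_basicOpen_le_affine_inter V.isAffineOpen W.isAffineOpen y
    ⟨hV, hW⟩
  have hL : ∃ U ∈ 𝒰, ∃ f' : Γ(X, U.1), X.basicOpen f = X.basicOpen f' := by
    obtain ⟨_, U, hU, a, rfl⟩ := V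
    obtain ⟨f', hf'⟩ := U.2.basicOpen_basicOpen_is_basicOpen a f
    exact ⟨U, hU, f', hf'.symm⟩
  exact ⟨⟨X.basicOpen f, hL⟩, ⟨f, rfl⟩, ⟨g, hfg⟩, hy⟩

theorem exists_mem_principalChart (h𝒰 : ∀ y : X, ∃ U ∈ 𝒰, y ∈ U.1) (y : X) :
    ∃ V : X.PrincipalChart 𝒰, y ∈ V.1 := by
  obtain ⟨U, hU, hy⟩ := h𝒰 y
  exact ⟨⟨U.1, U, hU, 1, X.basicOpen_one.symm⟩, hy⟩

end charts

section berkovich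

variable {X : Scheme.{u}} {k : Type u} [Field k] {π : X ⟶ Spec (CommRingCat.of k)}
  {ν : SemiringValuation k TropicalReal} {V : X.Opens}

/-- The multiplicative seminorm `f ↦ |f(z)|` on the functions on `V` that is given by a point `z` of
the analytification over `V`. -/
noncomputable def seminorm (V : X.Opens) (z : {z : BerkovichPoint π ν // z.pt ∈ V}) :
    Γ(X, V) →*₀ ℝ :=
  z.1.abv.toMonoidWithZeroHom.comp (X.evaluation V z.1.pt z.2).hom.toMonoidWithZeroHom

theorem seminorm_apply (z : {z : BerkovichPoint π ν // z.pt ∈ V}) (f : Γ(X, V)) :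
    seminorm V z f = z.1.abv (X.evaluation V z.1.pt z.2 f) := rfl

theorem seminorm_nonneg (z : {z : BerkovichPoint π ν // z.pt ∈ V}) (f : Γ(X, V)) :
    0 ≤ seminorm V z f := z.1.abv.nonneg _

theorem seminorm_add_le (z : {z : BerkovichPoint π ν // z.pt ∈ V}) (f g : Γ(X, V)) :
    seminorm V z (f + g) ≤ max (seminorm V z f) (seminorm V z g) := by
  rw [seminorm_apply, map_add]
  exact z.1.nonarchimedean _ _

theorem seminorm_res {U : X.Opens} (h : V ≤ U) (z : {z : BerkovichPoint π ν // z.pt ∈ V})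
    (f : Γ(X, U)) :
    seminorm V z (X.presheaf.map (homOfLE h).op f) = seminorm U ⟨z.1, h z.2⟩ f :=
  congrArg z.1.abv (evaluation_res h z.2 f)

theorem evaluation_scalars {y : X} (hy : y ∈ V) (c : k) :
    X.evaluation V y hy (scalars π V c) = X.evaluation ⊤ y trivial (scalars π ⊤ c) := by
  rw [← map_scalars π (le_top : V ≤ ⊤), evaluation_res]

theorem seminorm_scalars (z : {z : BerkovichPoint π ν // z.pt ∈ V}) (c : k) :
    seminorm V z (scalars π V c) = (ν.toFun c).exp := by
  rw [seminorm_apply, evaluation_scalars, z.1.extends_abs]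

theorem seminorm_ne_zero_iff {z : {z : BerkovichPoint π ν // z.pt ∈ V}} {f : Γ(X, V)} :
    seminorm V z f ≠ 0 ↔ z.1.pt ∈ X.basicOpen f :=
  z.1.abv.ne_zero_iff.trans (X.evaluation_ne_zero_iff_mem_basicOpen _ z.2 f)

theorem seminorm_injective (hV : IsAffineOpen V) :
    Function.Injective (seminorm V : {z : BerkovichPoint π ν // z.pt ∈ V} → _) := by
  rintro ⟨z, hz⟩ ⟨z', hz'⟩ h
  have hpt : z.pt = z'.pt := eq_of_evaluation_eq_zero_iff hV hz hz' fun f => by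
    rw [← z.abv.eq_zero, ← z'.abv.eq_zero]
    exact (DFunLike.congr_fun h f).congr_left
  obtain ⟨y, v, hv, hv'⟩ := z
  obtain ⟨y', v', _, _⟩ := z'
  dsimp only at hpt hz hz'
  subst hpt
  congr
  ext c
  obtain ⟨a, b, hb, hc⟩ := exists_mul_evaluation_eq hV hz c
  have heval (f : Γ(X, V)) : v (X.evaluation V y hz f) = v' (X.evaluation V y hz f) :=
    DFunLike.congr_fun h f
  refine mul_right_cancel₀ (v.ne_zero hb) ?_
  rw [← map_mul, hc, heval a, heval b, ← map_mul, hc]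

theorem exists_seminorm_eq_exp (hV : IsAffineOpen V) (v : Valuation Γ(X, V) TropicalReal)
    (hv : ∀ c, v (scalars π V c) = ν.toFun c) :
    ∃ z : {z : BerkovichPoint π ν // z.pt ∈ V}, ∀ f, seminorm V z f = (v f).exp := by
  obtain ⟨y, hy, hker⟩ := exists_evaluation_eq_zero_iff hV ⟨v.supp, inferInstance⟩
  obtain ⟨w, rfl⟩ := exists_valuation_comap_eq v (X.evaluation V y hy).hom (Ideal.ext hker)
    (exists_mul_evaluation_eq hV hy)
  exact ⟨⟨⟨y, TropicalReal.absoluteValue w, TropicalReal.isNonarchimedean_absoluteValue w,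
    fun c => congrArg TropicalReal.exp (evaluation_scalars hy c ▸ hv c)⟩, hy⟩, fun f => rfl⟩

theorem exists_algHom_exp_eq_seminorm (z : {z : BerkovichPoint π ν // z.pt ∈ V}) :
    ∃ q : ScalarExt TropicalReal Γ(X, V) →ₐ[TropicalReal] TropicalReal,
      ∀ f, seminorm V z f = (q (.x f)).exp := by
  obtain ⟨w, hw⟩ := TropicalReal.exists_monoidWithZeroHom_exp_eq _ (seminorm_nonneg z)
  refine ⟨ScalarExt.lift w, fun f => ?_⟩
  rw [ScalarExt.lift_x, hw]

theorem continuous_seminorm_apply (f : Γ(X, V)) :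
    Continuous fun z : {z : BerkovichPoint π ν // z.pt ∈ V} => seminorm V z f := by
  refine continuous_def.2 fun D hD => ⟨_, .basic _ (.inr ⟨V, f, D, hD, rfl⟩), ?_⟩
  ext z
  exact exists_prop_of_true z.2

theorem isOpen_preimage_of_continuous_seminorm (hV : IsAffineOpen V) {Z : Type*}
    [TopologicalSpace Z] {p : Z → {z : BerkovichPoint π ν // z.pt ∈ V}}
    (hp : ∀ f, Continuous fun t => seminorm V (p t) f) {U : X.Opens} (f : Γ(X, U)) {D : Set ℝ}
    (hD : IsOpen D) : IsOpen {t | ∃ ht : (p t).1.pt ∈ U, seminorm U ⟨(p t).1, ht⟩ f ∈ D} := by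
  refine isOpen_iff_mem_nhds.2 ?_
  rintro t₀ ⟨ht₀, hD₀⟩
  obtain ⟨g, h, n, hg, H⟩ := exists_evaluation_mul_pow_eq hV ht₀ (p t₀).2 f
  have hdiv (t : Z) (hg : seminorm V (p t) g ≠ 0) : ∃ ht : (p t).1.pt ∈ U,
      seminorm U ⟨(p t).1, ht⟩ f = seminorm V (p t) h / seminorm V (p t) g ^ n := by
    obtain ⟨ht, heval⟩ := H _ (p t).2 (seminorm_ne_zero_iff.1 hg)
    refine ⟨ht, (eq_div_iff (pow_ne_zero n hg)).2 ?_⟩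
    rw [seminorm_apply, seminorm_apply, seminorm_apply, ← heval, map_mul, map_pow]
  have hg₀ : seminorm V (p t₀) g ≠ 0 := seminorm_ne_zero_iff.2 hg
  have hcont : ContinuousAt (fun t => seminorm V (p t) h / seminorm V (p t) g ^ n) t₀ :=
    (hp h).continuousAt.div₀ ((hp g).continuousAt.pow n) (pow_ne_zero n hg₀)
  obtain ⟨_, hdiv₀⟩ := hdiv t₀ hg₀
  filter_upwards [(hp g).continuousAt.eventually_ne hg₀,
    hcont.preimage_mem_nhds (hD.mem_nhds (hdiv₀ ▸ hD₀))] with t hgt hDt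
  obtain ⟨ht, hdivt⟩ := hdiv t hgt
  exact ⟨ht, hdivt ▸ hDt⟩

theorem continuous_iff_continuous_seminorm (hV : IsAffineOpen V) {Z : Type*} [TopologicalSpace Z]
    {p : Z → {z : BerkovichPoint π ν // z.pt ∈ V}} :
    Continuous p ↔ ∀ f, Continuous fun t => seminorm V (p t) f := by
  refine ⟨fun hp f => (continuous_seminorm_apply f).comp hp, fun hp =>
    continuous_induced_rng.2 (continuous_generateFrom_iff.2 ?_)⟩
  rintro _ (⟨U, rfl⟩ | ⟨U, f, D, hD, rfl⟩)
  · convert isOpen_preimage_of_continuous_seminorm hV hp (0 : Γ(X, U)) isOpen_univ using 1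
    ext t
    simp
  · exact isOpen_preimage_of_continuous_seminorm hV hp f hD

end berkovich

section comparison

variable {X : Scheme.{u}} [IsIntegral X] {𝒰 : Set X.affineOpens} {k : Type u} [Field k]
  {π : X ⟶ Spec (CommRingCat.of k)} {ν : SemiringValuation k TropicalReal}
  {V : X.PrincipalChart 𝒰}

variable (𝒰 π ν) in
/-- The universal tropicalization as a closed subscheme of `M(X) ×_{𝔽₁} 𝕋`. -/
noncomputable abbrev subscheme :
    ((X.scalarRestriction 𝒰).baseChange TropicalReal).ClosedSubscheme :=
  (X.scalarRestriction 𝒰).tropicalization ν (universalEmbedding 𝒰 π)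

theorem forall_con_imp_iff (q : ScalarExt TropicalReal Γ(X, V.1) →ₐ[TropicalReal] TropicalReal) :
    (∀ f g, (subscheme 𝒰 π ν).con V f g → q f = q g) ↔
      (∀ a b, q (.x (a + b)) ≤ q (.x a) + q (.x b)) ∧
        ∀ c, q (.x (scalars π V.1 c)) = ν.toFun c := by
  let : Algebra k Γ(X, V.1) := (scalars π V.1).toAlgebra
  refine (ScalarExt.forall_bend_trop_imp_iff q ν _).trans <|
    .trans ?_ (ScalarExt.forall_maxAttainedTwice_iff ν q)
  refine forall_congr' fun f => imp_congr_left ?_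
  change ev π V.1 f = ev π V.1 0 ↔ ev π V.1 f = 0
  rw [map_zero]

theorem exists_seminorm_eq_exp_iff
    (q : ScalarExt TropicalReal Γ(X, V.1) →ₐ[TropicalReal] TropicalReal) :
    (∃ z : {z : BerkovichPoint π ν // z.pt ∈ V.1}, ∀ f, seminorm V.1 z f = (q (.x f)).exp) ↔
      ∀ f g, (subscheme 𝒰 π ν).con V f g → q f = q g := by
  rw [forall_con_imp_iff]
  constructor
  · rintro ⟨z, hz⟩
    refine ⟨fun a b => ?_, fun c => TropicalReal.exp_injective ?_⟩
    · rw [← TropicalReal.exp_strictMono.le_iff_le, TropicalReal.exp_add, ← hz, ← hz, ← hz]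
      exact seminorm_add_le z a b
    · rw [← hz, seminorm_scalars]
  · rintro ⟨hadd, hscalar⟩
    let v : Valuation Γ(X, V.1) TropicalReal :=
      { q.toRingHom.toMonoidWithZeroHom.comp ScalarExt.x with map_add_le_max' := hadd }
    exact exists_seminorm_eq_exp V.isAffineOpen v hscalar

theorem exists_seminorm_eq_exp_quotMap
    (φ : (universalTropicalization 𝒰 π ν).alg V →ₐ[TropicalReal] TropicalReal) :
    ∃ z : {z : BerkovichPoint π ν // z.pt ∈ V.1},
      ∀ f, seminorm V.1 z f = (φ ((subscheme 𝒰 π ν).quotMap V (.x f))).exp :=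
  (exists_seminorm_eq_exp_iff (φ.comp ((subscheme 𝒰 π ν).quotMap V))).2
    ((subscheme 𝒰 π ν).comp_quotMap_eq_of_con φ)

/-- The point of the analytification over `V` that is given by a tropical point `φ` of the patch of
`V`, characterized by `|f(z)| = exp (φ (x_f))`. -/
noncomputable def chartPoint
    (φ : (universalTropicalization 𝒰 π ν).alg V →ₐ[TropicalReal] TropicalReal) :
    {z : BerkovichPoint π ν // z.pt ∈ V.1} :=
  (exists_seminorm_eq_exp_quotMap φ).choose

theorem seminorm_chartPoint
    (φ : (universalTropicalization 𝒰 π ν).alg V →ₐ[TropicalReal] TropicalReal) (f : Γ(X, V.1)) :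
    seminorm V.1 (chartPoint φ) f = (φ ((subscheme 𝒰 π ν).quotMap V (.x f))).exp :=
  (exists_seminorm_eq_exp_quotMap φ).choose_spec f

theorem eq_chartPoint_iff
    {φ : (universalTropicalization 𝒰 π ν).alg V →ₐ[TropicalReal] TropicalReal}
    {z : {z : BerkovichPoint π ν // z.pt ∈ V.1}} :
    z = chartPoint φ ↔
      ∀ f, seminorm V.1 z f = (φ ((subscheme 𝒰 π ν).quotMap V (.x f))).exp := by
  refine ⟨fun h => h ▸ seminorm_chartPoint φ, fun h => seminorm_injective V.isAffineOpen ?_⟩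
  ext f
  rw [h, seminorm_chartPoint]

theorem chartPoint_bijective :
    Function.Bijective (chartPoint : ((universalTropicalization 𝒰 π ν).alg V →ₐ[TropicalReal]
      TropicalReal) → {z : BerkovichPoint π ν // z.pt ∈ V.1}) := by
  refine ⟨fun φ ψ h => (subscheme 𝒰 π ν).comp_quotMap_injective V <| ScalarExt.algHom_ext fun f =>
    TropicalReal.exp_injective ?_, fun z => ?_⟩
  · exact (seminorm_chartPoint φ f).symm.trans (h ▸ seminorm_chartPoint ψ f)
  · obtain ⟨q, hq⟩ := exists_algHom_exp_eq_seminorm z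
    exact ⟨(subscheme 𝒰 π ν).liftHom q ((exists_seminorm_eq_exp_iff q).1 ⟨z, hq⟩),
      (eq_chartPoint_iff.2 hq).symm⟩

theorem continuous_chartPoint : Continuous (chartPoint : ((universalTropicalization 𝒰 π ν).alg V
    →ₐ[TropicalReal] TropicalReal) → {z : BerkovichPoint π ν // z.pt ∈ V.1}) := by
  refine (continuous_iff_continuous_seminorm V.isAffineOpen).2 fun f => ?_
  simp only [seminorm_chartPoint]
  exact TropicalReal.isEmbedding_exp.continuous.comp (TropicalReal.continuous_apply _)

theorem isHomeomorph_chartPoint : IsHomeomorph (chartPoint :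
    ((universalTropicalization 𝒰 π ν).alg V →ₐ[TropicalReal] TropicalReal) →
      {z : BerkovichPoint π ν // z.pt ∈ V.1}) := by
  let e := Equiv.ofBijective _ (chartPoint_bijective (π := π) (ν := ν) (V := V))
  refine (Homeomorph.mk e continuous_chartPoint ?_).isHomeomorph
  refine (ScalarExt.continuous_algHom_iff_of_surjective
    ((subscheme 𝒰 π ν).quotMap_surjective V)).2 fun f =>
      TropicalReal.isEmbedding_exp.continuous_iff.2 ?_
  refine (continuous_seminorm_apply f).congr fun z => ?_
  exact (congrArg (seminorm V.1 · f) (e.apply_symm_apply z)).symm.trans (seminorm_chartPoint _ f)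

theorem chartPoint_comp_res {W : X.PrincipalChart 𝒰} (h : V ≤ W)
    (χ : (universalTropicalization 𝒰 π ν).alg V →ₐ[TropicalReal] TropicalReal) :
    (chartPoint (χ.comp ((universalTropicalization 𝒰 π ν).res h))).1 = (chartPoint χ).1 := by
  have hVW := PrincipalChart.le_opens h
  have : (⟨_, hVW (chartPoint χ).2⟩ : {z : BerkovichPoint π ν // z.pt ∈ W.1}) =
      chartPoint (χ.comp ((universalTropicalization 𝒰 π ν).res h)) := by
    refine eq_chartPoint_iff.2 fun f => ?_
    rw [← seminorm_res hVW (chartPoint χ), seminorm_chartPoint]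
    exact congrArg (fun a => (χ ((subscheme 𝒰 π ν).quotMap V a)).exp)
      (ScalarExt.map_x ((X.scalarRestriction 𝒰).res h) f).symm
  exact congrArg Subtype.val this.symm

/-- The point of the analytification that is given by a tropical point. -/
noncomputable def toBerkovichPoint :
    (universalTropicalization 𝒰 π ν).Points TropicalReal → BerkovichPoint π ν :=
  Quot.lift (fun p => (chartPoint p.2).1) <| by
    rintro ⟨V, φ⟩ ⟨W, ψ⟩ ⟨L, hV, hW, χ, hφ, hψ⟩
    dsimp only at hV hW hφ hψ ⊢
    rw [← hφ, ← hψ]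
    exact (chartPoint_comp_res hV χ).trans (chartPoint_comp_res hW χ).symm

theorem toBerkovichPoint_point
    (φ : (universalTropicalization 𝒰 π ν).alg V →ₐ[TropicalReal] TropicalReal) :
    toBerkovichPoint ((universalTropicalization 𝒰 π ν).point V φ) = (chartPoint φ).1 := rfl

theorem toBerkovichPoint_injective : Function.Injective (toBerkovichPoint :
    (universalTropicalization 𝒰 π ν).Points TropicalReal → BerkovichPoint π ν) := by
  intro p q h
  obtain ⟨V, φ, rfl⟩ := SemiringScheme.exists_point_eq p
  obtain ⟨W, ψ, rfl⟩ := SemiringScheme.exists_point_eq q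
  rw [toBerkovichPoint_point, toBerkovichPoint_point] at h
  obtain ⟨L, hLV, hLW, hL⟩ := exists_principalChart_le_le V W (chartPoint φ).2
    (h ▸ (chartPoint ψ).2)
  obtain ⟨χ, hχ⟩ := chartPoint_bijective.2 (⟨_, hL⟩ : {z : BerkovichPoint π ν // z.pt ∈ L.1})
  have hφ : χ.comp ((universalTropicalization 𝒰 π ν).res hLV) = φ :=
    chartPoint_bijective.1 <| Subtype.ext <| (chartPoint_comp_res hLV χ).trans (hχ ▸ rfl)
  have hψ : χ.comp ((universalTropicalization 𝒰 π ν).res hLW) = ψ :=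
    chartPoint_bijective.1 <| Subtype.ext <| (chartPoint_comp_res hLW χ).trans (hχ ▸ h)
  exact SemiringScheme.point_eq_point_iff.2 ⟨L, hLV, hLW, χ, hφ, hψ⟩

theorem toBerkovichPoint_surjective (h𝒰 : ∀ y : X, ∃ U ∈ 𝒰, y ∈ U.1) :
    Function.Surjective (toBerkovichPoint :
      (universalTropicalization 𝒰 π ν).Points TropicalReal → BerkovichPoint π ν) := by
  intro z
  obtain ⟨V, hV⟩ := exists_mem_principalChart h𝒰 z.pt
  obtain ⟨φ, hφ⟩ := chartPoint_bijective.2 (⟨z, hV⟩ : {z : BerkovichPoint π ν // z.pt ∈ V.1})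
  exact ⟨(universalTropicalization 𝒰 π ν).point V φ, congrArg Subtype.val hφ⟩

theorem continuous_toBerkovichPoint : Continuous (toBerkovichPoint :
    (universalTropicalization 𝒰 π ν).Points TropicalReal → BerkovichPoint π ν) := by
  refine continuous_def.2 fun O hO =>
    SemiringScheme.isOpen_iff_forall_isOpen_preimage_point.2 fun V => ?_
  exact hO.preimage (continuous_subtype_val.comp continuous_chartPoint)

theorem isOpenMap_toBerkovichPoint : IsOpenMap (toBerkovichPoint :
    (universalTropicalization 𝒰 π ν).Points TropicalReal → BerkovichPoint π ν) := by
  intro O hO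
  have himage : toBerkovichPoint '' O = ⋃ V : X.PrincipalChart 𝒰, Subtype.val ''
      (chartPoint '' ((universalTropicalization 𝒰 π ν).point V ⁻¹' O)) := by
    ext z
    simp only [Set.mem_iUnion, Set.image_image, Set.mem_image, Set.mem_preimage]
    constructor
    · rintro ⟨p, hp, rfl⟩
      obtain ⟨V, φ, rfl⟩ := SemiringScheme.exists_point_eq p
      exact ⟨V, φ, hp, rfl⟩
    · rintro ⟨V, φ, hφ, rfl⟩
      exact ⟨_, hφ, rfl⟩
  rw [himage]
  refine isOpen_iUnion fun V => ?_
  have hV : IsOpen {z : BerkovichPoint π ν | z.pt ∈ V.1} := .basic _ (.inl ⟨V.1, rfl⟩)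
  exact hV.isOpenMap_subtype_val _ <| isHomeomorph_chartPoint.isOpenMap _ <|
    hO.preimage (SemiringScheme.continuous_point V)

theorem isHomeomorph_toBerkovichPoint (h𝒰 : ∀ y : X, ∃ U ∈ 𝒰, y ∈ U.1) :
    IsHomeomorph (toBerkovichPoint :
      (universalTropicalization 𝒰 π ν).Points TropicalReal → BerkovichPoint π ν) :=
  ⟨continuous_toBerkovichPoint, isOpenMap_toBerkovichPoint, toBerkovichPoint_injective,
    toBerkovichPoint_surjective h𝒰⟩

end comparison

end UniversalTropicalization

/-- The universal tropicalization of an integral scheme `X` over a non-archimedean valued field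
`(k, ν)`, formed with an arbitrary affine open covering `𝒰` of `X`.
* Its tropical points are those of the set-theoretic tropicalization of `X` in `M(X) ×_{𝔽₁} k`.
* There is a unique homeomorphism from its tropical points, with the strong Zariski topology, to the
  Berkovich analytification that sends a tropical point `φ` of the patch over `V` to the
  point `z` over `V` with `|f(z)| = exp (φ (x_f))` for all functions `f` on `V`.
* The closed sets of the strong Zariski topology are exactly the sets of tropical points of closed
  subschemes. -/
theorem theoremA {k : Type u} [Field k] (ν : SemiringValuation k TropicalReal)
    (X : Scheme.{u}) [IsIntegral X] (π : X ⟶ Spec (CommRingCat.of k))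
    (𝒰 : Set X.affineOpens) (h𝒰 : ∀ y : X, ∃ U ∈ 𝒰, y ∈ U.1) :
    (Function.Injective (((X.scalarRestriction 𝒰).tropicalization ν
        (Scheme.universalEmbedding 𝒰 π)).incl TropicalReal) ∧
      Set.range (((X.scalarRestriction 𝒰).tropicalization ν
        (Scheme.universalEmbedding 𝒰 π)).incl TropicalReal) =
      (X.scalarRestriction 𝒰).setTropicalization ν (Scheme.universalEmbedding 𝒰 π)) ∧
    (∃! e : (Scheme.universalTropicalization 𝒰 π ν).Points TropicalReal ≃ₜ
        Scheme.BerkovichPoint π ν,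
      ∀ (V : X.PrincipalChart 𝒰)
        (φ : (Scheme.universalTropicalization 𝒰 π ν).alg V →ₐ[TropicalReal] TropicalReal),
        ∃ hV : (e ((Scheme.universalTropicalization 𝒰 π ν).point V φ)).pt ∈ V.1,
          ∀ f : Γ(X, V.1),
            (e ((Scheme.universalTropicalization 𝒰 π ν).point V φ)).abv
                (X.evaluation V.1 _ hV f) =
              (φ (((X.scalarRestriction 𝒰).tropicalization ν
                (Scheme.universalEmbedding 𝒰 π)).quotMap V (ScalarExt.x f))).exp) ∧
    (∀ C : Set ((Scheme.universalTropicalization 𝒰 π ν).Points TropicalReal),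
      IsClosed C ↔
        ∃ Z : (Scheme.universalTropicalization 𝒰 π ν).ClosedSubscheme,
          C = Z.points TropicalReal) := by
  refine ⟨⟨SemiringScheme.ClosedSubscheme.incl_injective _,
      F1Scheme.range_incl_tropicalization _ ν _⟩,
    ⟨(UniversalTropicalization.isHomeomorph_toBerkovichPoint h𝒰).homeomorph, fun V φ =>
      ⟨(UniversalTropicalization.chartPoint φ).2, UniversalTropicalization.seminorm_chartPoint φ⟩,
      fun e he => Homeomorph.ext fun p => ?_⟩,
    fun C => SemiringScheme.isClosed_iff_exists_eq_points⟩
  obtain ⟨V, φ, rfl⟩ := SemiringScheme.exists_point_eq p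
  obtain ⟨hV, hφ⟩ := he V φ
  let z : {z : Scheme.BerkovichPoint π ν // z.pt ∈ V.1} := ⟨_, hV⟩
  have hz : z = UniversalTropicalization.chartPoint φ :=
    UniversalTropicalization.eq_chartPoint_iff.2 hφ
  exact congrArg Subtype.val hz
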